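/- Let $G$ be a finite simple graph that is 2-connected (that is, $G$ has at least three vertices, is connected, and remains connected after the deletion of any single vertex). Let $x_1, x_2, y, z$ be four distinct vertices of degree 2 in $G$, and suppose that every vertex $v \in V(G)\setminus\{x_1,x_2,y,z\}$ has degree 3. Suppose further that $x_1$ and $x_2$ are not adjacent, and that they are not opposite vertices of a 4-cycle in $G$ (that is, $G$ contains no 4-cycle, induced or not, of the form $x_1 a x_2 b x_1$). Then there are two paths $P_1$, $P_2$ in $G$ from $x_1$ to $x_2$ such that $|E(P_1)|-|E(P_2)|\in\{1,2\}$. -/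

import Mathlib

/-- A graph is 2-connected if it has at least three vertices, is connected, and stays connected
after the deletion of any single vertex. -/
def SimpleGraph.IsTwoConnected {V : Type*} [Fintype V] (G : SimpleGraph V) : Prop :=
  3 ≤ Fintype.card V ∧ G.Connected ∧ ∀ v : V, (G.induce ({v}ᶜ : Set V)).Connected

/-- `u` and `v` are opposite vertices of a 4-cycle `u, a, v, b` contained in `G` (not necessarily
as an induced subgraph). -/
def SimpleGraph.AreOppositeInFourCycle {V : Type*} (G : SimpleGraph V) (u v : V) : Prop :=
  ∃ a b : V, u ≠ v ∧ a ≠ b ∧ G.Adj u a ∧ G.Adj a v ∧ G.Adj v b ∧ G.Adj b u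

/-! Delete `x₁` and `x₂`, and let σ, τ be their neighbourhoods in the rest I. As the two are
nonadjacent, their paths are the σ-τ paths inside I lengthened by two edges, so it suffices to find
σ-τ paths with lengths differing by 1 or 2. What survives of 2-connectedness and of the degrees is
`IsRooted`, with X = {y, z} the exceptional vertices, whose degree is not bounded below. This class,
unlike that of cubic graphs, is closed under the reductions below, so induction on |I| works.

Suppose there are no close paths. An edge inside σ would give lengths n and n + 1. If c has two
neighbours a, b in σ, the detour a, c, b gives n and n + 2 unless c cuts a and b off from τ; then
the part behind c is a smaller rooted graph with c as second root. Otherwise each vertex outside σ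
has at most one neighbour in σ, so contracting σ into its root preserves degrees. The part still
joined to τ (`core`) is a smaller rooted graph; a component D of I \ σ missing τ is one too, with
roots a and σ \ {a} for a suitable a in σ.

With at most one exceptional vertex this always succeeds, unless I is just that vertex
(`closePaths_or_singleton`). With two, each cut-off part must therefore contain both, and a second
induction (`eq_and_ncard_eq_two`) leaves one obstruction when |σ|, |τ| ≥ 2: σ = τ with two elements.
For `x₁`, `x₂` that is the excluded 4-cycle. -/

namespace SimpleGraph

variable {V : Type*} {G : SimpleGraph V}

/-! ### Walks confined to a vertex set -/

/-- `v` is joined to a vertex of `P` by a walk inside `S`. -/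
inductive ReachIn (G : SimpleGraph V) (S P : Set V) : V → Prop
  | base {v : V} : v ∈ S → v ∈ P → ReachIn G S P v
  | step {v w : V} : v ∈ S → G.Adj v w → ReachIn G S P w → ReachIn G S P v

namespace ReachIn

variable {S T P Q J : Set V} {u v : V}

theorem mem (h : G.ReachIn S P v) : v ∈ S := by cases h <;> assumption

theorem mono (hS : S ⊆ T) (hP : ∀ x ∈ S, x ∈ P → x ∈ Q) (h : G.ReachIn S P v) :
    G.ReachIn T Q v := by
  induction h with
  | base h1 h2 => exact .base (hS h1) (hP _ h1 h2)
  | step h1 h2 _ ih => exact .step (hS h1) h2 ih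

theorem exists_mem (h : G.ReachIn S P v) : ∃ x ∈ P, x ∈ S := by
  induction h with
  | base h1 h2 => exact ⟨_, h2, h1⟩
  | step _ _ _ ih => exact ih

/-- Cutting a walk where it leaves `J`. -/
theorem restrict (h : G.ReachIn S P v) (hv : v ∈ J) (hP : ∀ x ∈ J, x ∈ S → x ∈ P → x ∈ Q)
    (hb : ∀ x ∈ J, x ∈ S → ∀ y ∈ S, y ∉ J → G.Adj x y → x ∈ Q) : G.ReachIn (S ∩ J) Q v := by
  induction h with
  | base h1 h2 => exact .base ⟨h1, hv⟩ (hP _ hv h1 h2)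
  | @step v w h1 h2 h3 ih =>
    by_cases hw : w ∈ J
    · exact .step ⟨h1, hv⟩ h2 (ih hw)
    · exact .base ⟨h1, hv⟩ (hb _ hv h1 _ h3.mem hw h2)

theorem union (h : G.ReachIn S (P ∪ Q) v) : G.ReachIn S P v ∨ G.ReachIn S Q v := by
  induction h with
  | base h1 h2 => exact h2.imp (.base h1) (.base h1)
  | step h1 h2 _ ih => exact ih.imp (.step h1 h2) (.step h1 h2)

theorem exists_common (h : G.ReachIn S P v) (h' : G.ReachIn S Q v) :
    ∃ p ∈ P, G.ReachIn S Q p := by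
  induction h with
  | base _ h2 => exact ⟨_, h2, h'⟩
  | step h1 h2 h3 ih => exact ih (.step h3.mem h2.symm h')

theorem trans (h : G.ReachIn S P v) (h' : ∀ p ∈ P, p ∈ S → G.ReachIn S Q p) :
    G.ReachIn S Q v := by
  induction h with
  | base h1 h2 => exact h' _ h2 h1
  | step h1 h2 _ ih => exact .step h1 h2 ih

theorem symm_single (h : G.ReachIn S {u} v) : G.ReachIn S {v} u := by
  have key : ∀ w, G.ReachIn S {u} w → G.ReachIn S {v} w → G.ReachIn S {v} u := by
    intro w hw hw'
    obtain ⟨p, hp, hp'⟩ := hw.exists_common hw'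
    exact Set.mem_singleton_iff.1 hp ▸ hp'
  exact key v h (.base h.mem rfl)

theorem self (h : G.ReachIn S P v) : G.ReachIn {x | x ∈ S ∧ G.ReachIn S P x} P v := by
  induction h with
  | base h1 h2 => exact .base ⟨h1, .base h1 h2⟩ h2
  | step h1 h2 h3 ih => exact .step ⟨h1, .step h1 h2 h3⟩ h2 ih

/-- The last vertex of `Q` on a walk to `P`. -/
theorem exists_last (h : G.ReachIn S P v) :
    G.ReachIn (S \ Q) P v ∨ ∃ x ∈ Q, G.ReachIn (S \ (Q \ {x})) P x := by
  induction h with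
  | @base v h1 h2 =>
    by_cases hv : v ∈ Q
    · exact .inr ⟨v, hv, .base ⟨h1, by simp⟩ h2⟩
    · exact .inl (.base ⟨h1, hv⟩ h2)
  | @step v w h1 h2 h3 ih =>
    rcases ih with ih | ih
    · by_cases hv : v ∈ Q
      · refine .inr ⟨v, hv, .step ⟨h1, by simp⟩ h2 (ih.mono ?_ fun _ _ h => h)⟩
        exact fun x hx => ⟨hx.1, fun h => hx.2 h.1⟩
      · exact .inl (.step ⟨h1, hv⟩ h2 ih)
    · exact .inr ih

end ReachIn

/-! ### Paths of prescribed length, and pairs of close length -/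

/-- There is a path of length `n` inside `I` from a vertex of `σ` to a vertex of `τ`. -/
def HasPathIn (G : SimpleGraph V) (I σ τ : Set V) (n : ℕ) : Prop :=
  ∃ u ∈ σ, ∃ v ∈ τ, ∃ p : G.Walk u v, p.IsPath ∧ (∀ x ∈ p.support, x ∈ I) ∧ p.length = n

namespace HasPathIn

variable {I I' J Q σ σ' τ τ' ρ : Set V} {m n : ℕ} {u v : V}

theorem nil (hI : u ∈ I) (hσ : u ∈ σ) (hτ : u ∈ τ) : G.HasPathIn I σ τ 0 :=
  ⟨u, hσ, u, hτ, .nil, by simp, by simpa using hI, rfl⟩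

theorem symm (h : G.HasPathIn I σ τ n) : G.HasPathIn I τ σ n := by
  obtain ⟨u, hu, v, hv, p, hp, hs, hl⟩ := h
  exact ⟨v, hv, u, hu, p.reverse, hp.reverse, by simpa using hs, by simpa using hl⟩

theorem mono (hI : I ⊆ I') (hσ : σ ⊆ σ') (hτ : τ ⊆ τ') (h : G.HasPathIn I σ τ n) :
    G.HasPathIn I' σ' τ' n := by
  obtain ⟨u, hu, v, hv, p, hp, hs, hl⟩ := h
  exact ⟨u, hσ hu, v, hτ hv, p, hp, fun x hx => hI (hs x hx), hl⟩

theorem cons (h : G.HasPathIn I {v} τ n) (hu : u ∉ I) (huv : G.Adj u v) :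
    G.HasPathIn (insert u I) {u} τ (n + 1) := by
  obtain ⟨v', rfl, w, hw, p, hp, hs, hl⟩ := h
  refine ⟨u, rfl, w, hw, .cons huv p, ?_, ?_, by simpa using hl⟩
  · exact (Walk.cons_isPath_iff _ _).2 ⟨hp, fun h => hu (hs u h)⟩
  · intro x hx
    rw [Walk.support_cons, List.mem_cons] at hx
    exact hx.imp id (hs x)

/-- Continuing a path by an edge and a path of fixed length in a disjoint set. -/
theorem append (h : G.HasPathIn J σ ρ n) (hQ : ∀ v ∈ ρ, ∃ c, G.Adj v c ∧ G.HasPathIn Q {c} τ m)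
    (hd : Disjoint J Q) : G.HasPathIn (J ∪ Q) σ τ (n + 1 + m) := by
  obtain ⟨u, hu, v, hv, p, hp, hs, hl⟩ := h
  obtain ⟨c, hvc, c', rfl, w, hw, q, hq, hqs, hql⟩ := hQ v hv
  refine ⟨u, hu, w, hw, p.append (.cons hvc q), ?_, ?_, ?_⟩
  · rw [Walk.isPath_def, Walk.support_append, Walk.support_cons, List.tail_cons,
      List.nodup_append']
    exact ⟨hp.support_nodup, hq.support_nodup,
      fun x hx hx' => Set.disjoint_left.1 hd (hs x hx) (hqs x hx')⟩
  · intro x hx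
    rw [Walk.support_append, Walk.support_cons, List.tail_cons, List.mem_append] at hx
    exact hx.imp (hs x) (hqs x)
  · rw [Walk.length_append, Walk.length_cons]
    omega

end HasPathIn

theorem ReachIn.hasPathIn {S P : Set V} {v : V} (h : G.ReachIn S P v) :
    ∃ n, G.HasPathIn S {v} P n := by
  classical
  have : ∃ w ∈ P, ∃ p : G.Walk v w, ∀ x ∈ p.support, x ∈ S := by
    induction h with
    | base h1 h2 => exact ⟨_, h2, .nil, by simpa using h1⟩
    | step h1 h2 _ ih =>
      obtain ⟨w, hw, p, hp⟩ := ih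
      refine ⟨w, hw, .cons h2 p, fun x hx => ?_⟩
      rw [Walk.support_cons, List.mem_cons] at hx
      exact hx.elim (fun h => h ▸ h1) (hp x)
  obtain ⟨w, hw, p, hp⟩ := this
  exact ⟨_, v, rfl, w, hw, p.bypass, p.bypass_isPath,
    fun x hx => hp x (p.support_bypass_subset_support hx), rfl⟩

/-- There are two `σ`-`τ` paths inside `I` whose lengths differ by one or two. -/
def HasClosePaths (G : SimpleGraph V) (I σ τ : Set V) : Prop :=
  ∃ n, G.HasPathIn I σ τ n ∧ (G.HasPathIn I σ τ (n + 1) ∨ G.HasPathIn I σ τ (n + 2))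

namespace HasClosePaths

variable {I J σ τ σ' τ' : Set V}

theorem symm (h : G.HasClosePaths I σ τ) : G.HasClosePaths I τ σ := by
  obtain ⟨n, h1, h2⟩ := h
  exact ⟨n, h1.symm, h2.imp (·.symm) (·.symm)⟩

theorem lift (k : ℕ) (hk : ∀ n, G.HasPathIn J σ' τ' n → G.HasPathIn I σ τ (n + k))
    (h : G.HasClosePaths J σ' τ') : G.HasClosePaths I σ τ := by
  obtain ⟨n, h1, h2⟩ := h
  refine ⟨n + k, hk _ h1, h2.imp (fun h => ?_) fun h => ?_⟩
  · have := hk _ h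
    rwa [add_right_comm] at this
  · have := hk _ h
    rwa [add_right_comm] at this

end HasClosePaths

/-! ### Rooted graphs and their reductions -/

/-- The vertices of `J` with a neighbour in `S`. -/
def nbrsIn (G : SimpleGraph V) (S J : Set V) : Set V := {v | v ∈ J ∧ ∃ w ∈ S, G.Adj v w}

open Classical in
/-- The degree of `v` in the graph obtained from `G[I]` by adding two new vertices with
neighbourhoods `σ` and `τ`. -/
noncomputable def rootedDegree (G : SimpleGraph V) (I σ τ : Set V) (v : V) : ℕ :=
  (G.neighborSet v ∩ I).ncard + (if v ∈ σ then 1 else 0) + (if v ∈ τ then 1 else 0)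

/-- The graph obtained from `G[I]` by adding two adjacent vertices `s`, `t` with neighbourhoods
`σ`, `τ` in `I` has no cut vertex, and all vertices of `I` outside `X` have degree at least three
in it. -/
structure IsRooted (G : SimpleGraph V) (X I σ τ : Set V) : Prop where
  subset_left : σ ⊆ I
  subset_right : τ ⊆ I
  reach_left : ∀ v ∈ I, G.ReachIn I σ v
  reach_right : ∀ v ∈ I, G.ReachIn I τ v
  reach_diff : ∀ v ∈ I, ∀ u ∈ I, u ≠ v → G.ReachIn (I \ {v}) (σ ∪ τ) u
  three_le : ∀ v ∈ I, v ∉ X → 3 ≤ G.rootedDegree I σ τ v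

theorem rootedDegree_comm {I σ τ : Set V} {v : V} :
    G.rootedDegree I σ τ v = G.rootedDegree I τ σ v := by
  unfold rootedDegree
  omega

theorem ncard_nbrs_le [Finite V] {I J S : Set V} {v : V}
    (h : ∀ w ∈ I, G.Adj v w → w ∈ J ∨ w ∈ S)
    (hS : ∀ w ∈ S, ∀ w' ∈ S, G.Adj v w → G.Adj v w' → w = w') :
    (G.neighborSet v ∩ I).ncard ≤ (G.neighborSet v ∩ J).ncard + 1 := by
  have h1 : G.neighborSet v ∩ I ⊆ (G.neighborSet v ∩ J) ∪ (G.neighborSet v ∩ S) :=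
    fun w hw => (h w hw.2 hw.1).imp (⟨hw.1, ·⟩) (⟨hw.1, ·⟩)
  have h2 : (G.neighborSet v ∩ S).ncard ≤ 1 :=
    (Set.ncard_le_one (Set.toFinite _)).2 fun w hw w' hw' => hS w hw.2 w' hw'.2 hw.1 hw'.1
  have h3 := Set.ncard_le_ncard h1 (Set.toFinite _)
  have h4 := Set.ncard_union_le (G.neighborSet v ∩ J) (G.neighborSet v ∩ S)
  omega

theorem ncard_nbrs_mono [Finite V] {I J : Set V} {v : V} (h : ∀ w ∈ I, G.Adj v w → w ∈ J) :
    (G.neighborSet v ∩ I).ncard ≤ (G.neighborSet v ∩ J).ncard :=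
  Set.ncard_le_ncard (fun w hw => ⟨hw.1, h w hw.2 hw.1⟩) (Set.toFinite _)

/-- The vertices of `I` other than `c` that `c` separates from `τ`. -/
def behind (G : SimpleGraph V) (I τ : Set V) (c : V) : Set V :=
  {v | v ∈ I ∧ v ≠ c ∧ ¬ G.ReachIn (I \ {c}) τ v}

/-- The vertices of `I` outside `σ` that can reach `τ` without meeting `σ`. -/
def core (G : SimpleGraph V) (I σ τ : Set V) : Set V :=
  {v | v ∈ I \ σ ∧ G.ReachIn (I \ σ) τ v}

/-- The component of `d` in `I \ σ`. -/
def compIn (G : SimpleGraph V) (I σ : Set V) (d : V) : Set V :=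
  {v | G.ReachIn (I \ σ) {d} v}

namespace IsRooted

variable {X I J σ τ σ' τ' : Set V} {a b c d v : V}

theorem symm (h : G.IsRooted X I σ τ) : G.IsRooted X I τ σ where
  subset_left := h.subset_right
  subset_right := h.subset_left
  reach_left := h.reach_right
  reach_right := h.reach_left
  reach_diff v hv u hu huv := by
    rw [Set.union_comm]
    exact h.reach_diff v hv u hu huv
  three_le v hv hX := by
    rw [rootedDegree_comm]
    exact h.three_le v hv hX

/-- All reductions pass to a vertex subset J. A walk avoiding v either stays in J or first leaves it
at a vertex with an edge out of J. If all such vertices, and the old root neighbours in J, are new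
root neighbours, there is still no cut vertex. -/
theorem restrict (h : G.IsRooted X I σ τ) (hJ : J ⊆ I) (hσ' : σ' ⊆ J) (hτ' : τ' ⊆ J)
    (hσ : ∀ x ∈ J, x ∈ σ → x ∈ σ' ∪ τ') (hτ : ∀ x ∈ J, x ∈ τ → x ∈ σ' ∪ τ')
    (hb : ∀ x ∈ J, ∀ y ∈ I, y ∉ J → G.Adj x y → x ∈ σ' ∪ τ')
    (hl : ∀ v ∈ J, G.ReachIn J σ' v) (hr : ∀ v ∈ J, G.ReachIn J τ' v)
    (hd : ∀ v ∈ J, G.rootedDegree I σ τ v ≤ G.rootedDegree J σ' τ' v) :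
    G.IsRooted X J σ' τ' where
  subset_left := hσ'
  subset_right := hτ'
  reach_left := hl
  reach_right := hr
  reach_diff v hv u hu huv := by
    refine ((h.reach_diff v (hJ hv) u (hJ hu) huv).restrict (J := J) (Q := σ' ∪ τ') hu ?_ ?_).mono
      (fun x hx => ⟨hx.2, hx.1.2⟩) fun _ _ h => h
    · exact fun x hx _ hx' => hx'.elim (hσ x hx) (hτ x hx)
    · exact fun x hx _ y hy hyJ hxy => hb x hx y hy.1 hyJ hxy
  three_le v hv hX := (h.three_le v (hJ hv) hX).trans (hd v hv)

/-! ### Cutting at a vertex -/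

theorem behind_closed {x y : V} (hx : x ∈ G.behind I τ c) (hy : y ∈ I) (hyc : y ≠ c)
    (hxy : G.Adj x y) : y ∈ G.behind I τ c :=
  ⟨hy, hyc, fun h => hx.2.2 (.step ⟨hx.1, hx.2.1⟩ hxy h)⟩

theorem notMem_of_behind (hx : v ∈ G.behind I τ c) : v ∉ τ :=
  fun h => hx.2.2 (.base ⟨hx.1, hx.2.1⟩ h)

/-- The only edges leaving the part behind c, inside I, go to c. A vertex behind c thus loses at
most one neighbour, and regains that unit of degree from the new root c. -/
theorem rooted_behind [Finite V] (h : G.IsRooted X I σ τ) (hc : c ∈ I) :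
    G.IsRooted X (G.behind I τ c) (σ ∩ G.behind I τ c) (G.nbrsIn {c} (G.behind I τ c)) := by
  have hb : ∀ x ∈ G.behind I τ c, ∀ y ∈ I, y ∉ G.behind I τ c → G.Adj x y →
      x ∈ G.nbrsIn {c} (G.behind I τ c) := by
    intro x hx y hy hy' hxy
    have : y = c := by
      by_contra hne
      exact hy' (behind_closed hx hy hne hxy)
    exact ⟨hx, c, rfl, this ▸ hxy⟩
  refine h.restrict (fun x hx => hx.1) (fun x hx => hx.2) (fun x hx => hx.1)
    (fun x hx hx' => .inl ⟨hx', hx⟩) (fun x hx hx' => absurd hx' (notMem_of_behind hx))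
    (fun x hx y hy hy' hxy => .inr (hb x hx y hy hy' hxy)) ?_ ?_ ?_
  · intro v hv
    refine ((h.reach_diff c hc v hv.1 hv.2.1).restrict (J := G.behind I τ c) hv ?_ ?_).mono
      (Q := σ ∩ G.behind I τ c) (fun x hx => hx.2) fun x hx h => h
    · exact fun x hx _ hx' => hx'.elim (⟨·, hx⟩) fun h => absurd h (notMem_of_behind hx)
    · exact fun x hx _ y hy hy' hxy => absurd (behind_closed hx hy.1 hy.2 hxy) hy'
  · intro v hv
    refine ((h.reach_right v hv.1).restrict (J := G.behind I τ c) hv ?_ ?_).mono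
      (Q := G.nbrsIn {c} (G.behind I τ c)) (fun x hx => hx.2) fun x hx h => h
    · exact fun x hx _ hx' => absurd hx' (notMem_of_behind hx)
    · exact fun x hx _ y hy hy' hxy => hb x hx y hy hy' hxy
  · intro v hv
    have hτ := notMem_of_behind hv
    have hi : v ∈ σ ∩ G.behind I τ c ↔ v ∈ σ := ⟨fun h => h.1, fun h => ⟨h, hv⟩⟩
    unfold rootedDegree
    by_cases hvc : G.Adj v c
    · have h1 : v ∈ G.nbrsIn {c} (G.behind I τ c) := ⟨hv, c, rfl, hvc⟩
      have h2 : (G.neighborSet v ∩ I).ncard ≤ (G.neighborSet v ∩ G.behind I τ c).ncard + 1 := by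
        refine ncard_nbrs_le (S := {c}) (fun w hw hvw => ?_) fun w hw w' hw' _ _ => hw.trans hw'.symm
        by_cases hwc : w = c
        · exact .inr hwc
        · exact .inl (behind_closed hv hw hwc hvw)
      by_cases hs : v ∈ σ
      · rw [if_neg hτ, if_pos h1, if_pos hs, if_pos (hi.2 hs)]
        omega
      · rw [if_neg hτ, if_pos h1, if_neg hs, if_neg (mt hi.1 hs)]
        omega
    · have h2 : (G.neighborSet v ∩ I).ncard ≤ (G.neighborSet v ∩ G.behind I τ c).ncard :=
        ncard_nbrs_mono fun w hw hvw =>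
          behind_closed hv hw (fun h => hvc (h ▸ hvw)) hvw
      by_cases hs : v ∈ σ
      · rw [if_neg hτ, if_pos hs, if_pos (hi.2 hs)]
        omega
      · rw [if_neg hτ, if_neg hs, if_neg (mt hi.1 hs)]
        omega

/-- After its last visit to c, a walk from c to τ uses only vertices that reach τ without c, hence
none behind c. This supplies the common tail that extends paths behind c. -/
theorem reach_diff_behind (h : G.IsRooted X I σ τ) (hc : c ∈ I) :
    G.ReachIn (I \ G.behind I τ c) τ c := by
  have key : ∀ v, G.ReachIn I τ v →
      G.ReachIn (I \ G.behind I τ c) τ c ∨ G.ReachIn (I \ {c}) τ v := by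
    intro v hv
    induction hv with
    | @base v h1 h2 =>
      by_cases hvc : v = c
      · exact .inl (.base ⟨hc, fun h => h.2.1 rfl⟩ (hvc ▸ h2))
      · exact .inr (.base ⟨h1, hvc⟩ h2)
    | @step v w h1 h2 h3 ih =>
      rcases ih with ih | ih
      · exact .inl ih
      · by_cases hvc : v = c
        · refine .inl (.step ⟨hc, fun h => h.2.1 rfl⟩ (hvc ▸ h2) (ih.self.mono ?_ fun _ _ h => h))
          exact fun x hx => ⟨hx.1.1, fun h => h.2.2 hx.2⟩
        · exact .inr (.step ⟨h1, hvc⟩ h2 ih)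
  exact (key c (h.reach_right c hc)).elim id fun h => absurd rfl h.mem.2

theorem closePaths_of_behind (h : G.IsRooted X I σ τ) (hc : c ∈ I)
    (hg : G.HasClosePaths (G.behind I τ c) (σ ∩ G.behind I τ c)
      (G.nbrsIn {c} (G.behind I τ c))) : G.HasClosePaths I σ τ := by
  obtain ⟨m, hm⟩ := (h.reach_diff_behind hc).hasPathIn
  refine hg.lift (1 + m) fun n hn => ?_
  have := hn.append (m := m) (τ := τ) (Q := I \ G.behind I τ c) ?_ Set.disjoint_sdiff_right
  · rw [← add_assoc]
    exact this.mono (Set.union_subset (fun x hx => hx.1) fun x hx => hx.1)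
      Set.inter_subset_left subset_rfl
  · rintro v ⟨_, w, rfl, hvw⟩
    exact ⟨_, hvw, hm⟩

/-! ### Contracting one end -/

theorem mem_core_of_adj {x y : V} (hx : x ∈ G.core I σ τ) (hy : y ∈ I) (hyσ : y ∉ σ)
    (hxy : G.Adj x y) : y ∈ G.core I σ τ :=
  ⟨⟨hy, hyσ⟩, .step ⟨hy, hyσ⟩ hxy.symm hx.2⟩

/-- Since a vertex outside σ has at most one neighbour in σ, replacing σ by a single root keeps its
degree; without `h4` parallel edges would be lost. -/
theorem rooted_core [Finite V] (h : G.IsRooted X I σ τ)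
    (h4 : ∀ v ∈ I, v ∉ σ → ∀ a ∈ σ, ∀ b ∈ σ, G.Adj v a → G.Adj v b → a = b) :
    G.IsRooted X (G.core I σ τ) (G.nbrsIn σ (G.core I σ τ)) (τ ∩ G.core I σ τ) := by
  have hb : ∀ x ∈ G.core I σ τ, ∀ y ∈ I, y ∉ G.core I σ τ → G.Adj x y →
      x ∈ G.nbrsIn σ (G.core I σ τ) := by
    intro x hx y hy hy' hxy
    refine ⟨hx, y, ?_, hxy⟩
    by_contra hyσ
    exact hy' (mem_core_of_adj hx hy hyσ hxy)
  refine h.restrict (fun x hx => hx.1.1) (fun x hx => hx.1) (fun x hx => hx.2)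
    (fun x hx hx' => absurd hx' hx.1.2) (fun x hx hx' => .inr ⟨hx', hx⟩)
    (fun x hx y hy hy' hxy => .inl (hb x hx y hy hy' hxy)) ?_ ?_ ?_
  · intro v hv
    refine ((h.reach_left v hv.1.1).restrict (J := G.core I σ τ) hv ?_ ?_).mono
      (Q := G.nbrsIn σ (G.core I σ τ)) (fun x hx => hx.2) fun x hx h => h
    · exact fun x hx _ hx' => absurd hx' hx.1.2
    · exact fun x hx _ y hy hy' hxy => hb x hx y hy hy' hxy
  · intro v hv
    exact hv.2.self.mono (fun x hx => hx) fun x hx hx' => ⟨hx', hx⟩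
  · intro v hv
    have hi : v ∈ τ ∩ G.core I σ τ ↔ v ∈ τ := ⟨fun h => h.1, fun h => ⟨h, hv⟩⟩
    unfold rootedDegree
    by_cases hvc : v ∈ G.nbrsIn σ (G.core I σ τ)
    · have h2 : (G.neighborSet v ∩ I).ncard ≤ (G.neighborSet v ∩ G.core I σ τ).ncard + 1 := by
        refine ncard_nbrs_le (S := σ) (fun w hw hvw => ?_)
          fun w hw w' hw' => h4 v hv.1.1 hv.1.2 w hw w' hw'
        by_cases hwc : w ∈ σ
        · exact .inr hwc
        · exact .inl (mem_core_of_adj hv hw hwc hvw)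
      by_cases hs : v ∈ τ
      · rw [if_neg hv.1.2, if_pos hvc, if_pos hs, if_pos (hi.2 hs)]
        omega
      · rw [if_neg hv.1.2, if_pos hvc, if_neg hs, if_neg (mt hi.1 hs)]
        omega
    · have h2 : (G.neighborSet v ∩ I).ncard ≤ (G.neighborSet v ∩ G.core I σ τ).ncard :=
        ncard_nbrs_mono fun w hw hvw =>
          mem_core_of_adj hv hw (fun h => hvc ⟨hv, w, h, hvw⟩) hvw
      by_cases hs : v ∈ τ
      · rw [if_neg hv.1.2, if_pos hs, if_pos (hi.2 hs)]
        omega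
      · rw [if_neg hv.1.2, if_neg hs, if_neg (mt hi.1 hs)]
        omega

theorem closePaths_of_core (h : G.IsRooted X I σ τ)
    (hg : G.HasClosePaths (G.core I σ τ) (G.nbrsIn σ (G.core I σ τ)) (τ ∩ G.core I σ τ)) :
    G.HasClosePaths I σ τ := by
  refine hg.lift 1 fun n hn => ?_
  have := hn.symm.append (m := 0) (τ := σ) (Q := σ) ?_ ?_
  · exact this.symm.mono (Set.union_subset (fun x hx => hx.1.1) h.subset_left) subset_rfl
      Set.inter_subset_left
  · rintro v ⟨_, w, hw, hvw⟩
    exact ⟨_, hvw, .nil hw rfl hw⟩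
  · exact Set.disjoint_left.2 fun x hx => hx.1.2

/-! ### Components missed by the contraction -/

theorem mem_compIn_of_adj {x y : V} (hx : x ∈ G.compIn I σ d) (hy : y ∈ I) (hyσ : y ∉ σ)
    (hxy : G.Adj x y) : y ∈ G.compIn I σ d :=
  ReachIn.step (S := I \ σ) ⟨hy, hyσ⟩ hxy.symm hx

theorem compIn_notMem_core {x : V} (hd : ¬ G.ReachIn (I \ σ) τ d) (hx : x ∈ G.compIn I σ d) :
    ¬ G.ReachIn (I \ σ) τ x := by
  intro hx'
  obtain ⟨p, hp, hp'⟩ := ReachIn.exists_common hx hx'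
  exact hd (Set.mem_singleton_iff.1 hp ▸ hp')

theorem compIn_connected {x y : V} (hx : x ∈ G.compIn I σ d) (hy : y ∈ G.compIn I σ d) :
    G.ReachIn (G.compIn I σ d) {y} x := by
  have h1 : G.ReachIn (I \ σ) {y} x := by
    refine ReachIn.trans hx fun p hp _ => ?_
    rw [Set.mem_singleton_iff.1 hp]
    exact ReachIn.symm_single hy
  refine (h1.restrict (J := G.compIn I σ d) (Q := {y}) hx (fun _ _ _ h => h) ?_).mono
    (fun x hx => hx.2) fun _ _ h => h
  exact fun x hx _ z hz hz' hxz => absurd (mem_compIn_of_adj hx hz.1 hz.2 hxz) hz'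

/-- All edges from the component to the rest of I end in σ, at most one per vertex, so splitting σ
into a and σ \ {a} preserves degrees. The side σ \ {a} is reached because a is not a cut vertex. -/
theorem rooted_compIn [Finite V] (h : G.IsRooted X I σ τ)
    (h4 : ∀ v ∈ I, v ∉ σ → ∀ a ∈ σ, ∀ b ∈ σ, G.Adj v a → G.Adj v b → a = b)
    (ha : a ∈ σ) (hdI : d ∈ I) (hdσ : d ∉ σ) (had : G.Adj d a)
    (hd : ¬ G.ReachIn (I \ σ) τ d) :
    G.IsRooted X (G.compIn I σ d) (G.nbrsIn (σ \ {a}) (G.compIn I σ d))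
      (G.nbrsIn {a} (G.compIn I σ d)) := by
  set D := G.compIn I σ d
  have hDI : ∀ x ∈ D, x ∈ I ∧ x ∉ σ := fun x hx => ReachIn.mem (S := I \ σ) hx
  have hDτ : ∀ x ∈ D, x ∉ τ := fun x hx hx' =>
    compIn_notMem_core hd hx (.base (hDI x hx) hx')
  have hdD : d ∈ D := ReachIn.base (S := I \ σ) ⟨hdI, hdσ⟩ rfl
  have hb : ∀ x ∈ D, ∀ y ∈ I, y ∉ D → G.Adj x y →
      x ∈ G.nbrsIn (σ \ {a}) D ∪ G.nbrsIn {a} D := by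
    intro x hx y hy hy' hxy
    have hyσ : y ∈ σ := by
      by_contra hyσ
      exact hy' (mem_compIn_of_adj hx hy hyσ hxy)
    by_cases hya : y = a
    · exact .inr ⟨hx, y, hya, hxy⟩
    · exact .inl ⟨hx, y, ⟨hyσ, hya⟩, hxy⟩
  refine h.restrict (fun x hx => (hDI x hx).1) (fun x hx => hx.1) (fun x hx => hx.1)
    (fun x hx hx' => absurd hx' (hDI x hx).2) (fun x hx hx' => absurd hx' (hDτ x hx))
    hb ?_ ?_ ?_
  · intro v hv
    have h1 : G.ReachIn D (G.nbrsIn (σ \ {a}) D) d := by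
      refine ((h.reach_diff a (h.subset_left ha) d hdI (fun h => hdσ (h ▸ ha))).restrict
        (J := D) hdD ?_ ?_).mono
        (Q := G.nbrsIn (σ \ {a}) D) (fun x hx => hx.2) fun x hx h => h
      · exact fun x hx _ hx' =>
          hx'.elim (fun h => absurd h (hDI x hx).2) fun h => absurd h (hDτ x hx)
      · intro x hx _ y hy hy' hxy
        refine ⟨hx, y, ⟨?_, hy.2⟩, hxy⟩
        by_contra hyσ
        exact hy' (mem_compIn_of_adj hx hy.1 hyσ hxy)
    refine (compIn_connected hv hdD).trans fun p hp _ => ?_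
    rw [Set.mem_singleton_iff.1 hp]
    exact h1
  · intro v hv
    exact (compIn_connected hv hdD).mono subset_rfl fun x hx hx' =>
      ⟨hx, a, rfl, (Set.mem_singleton_iff.1 hx').symm ▸ had⟩
  · intro v hv
    unfold rootedDegree
    by_cases hvc : v ∈ G.nbrsIn (σ \ {a}) D ∪ G.nbrsIn {a} D
    · have h2 : (G.neighborSet v ∩ I).ncard ≤ (G.neighborSet v ∩ D).ncard + 1 := by
        refine ncard_nbrs_le (S := σ) (fun w hw hvw => ?_)
          fun w hw w' hw' => h4 v (hDI v hv).1 (hDI v hv).2 w hw w' hw'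
        by_cases hwc : w ∈ σ
        · exact .inr hwc
        · exact .inl (mem_compIn_of_adj hv hw hwc hvw)
      simp only [(hDI v hv).2, hDτ v hv, if_false]
      rcases hvc with hvc | hvc
      · simp only [hvc, if_true]
        omega
      · simp only [hvc, if_true]
        omega
    · have h2 : (G.neighborSet v ∩ I).ncard ≤ (G.neighborSet v ∩ D).ncard := by
        refine ncard_nbrs_mono fun w hw hvw => ?_
        by_contra hwD
        exact hvc (hb v hv w hw hwD hvw)
      simp only [(hDI v hv).2, hDτ v hv, if_false]
      omega

theorem closePaths_of_compIn (h : G.IsRooted X I σ τ) (ha : a ∈ σ)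
    (hd : ¬ G.ReachIn (I \ σ) τ d) (hexit : G.ReachIn (insert a (G.core I σ τ)) τ a)
    (hg : G.HasClosePaths (G.compIn I σ d) (G.nbrsIn (σ \ {a}) (G.compIn I σ d))
      (G.nbrsIn {a} (G.compIn I σ d))) : G.HasClosePaths I σ τ := by
  obtain ⟨m, hm⟩ := hexit.hasPathIn
  -- Each path enters the component from σ \ {a}, leaves it to a, and follows the fixed exit of
  -- length m: two extra edges plus m.
  refine hg.lift (m + 2) fun n hn => ?_
  have h1 := hn.append (m := m) (τ := τ) (Q := insert a (G.core I σ τ)) ?_ ?_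
  · have h2 := h1.symm.append (m := 0) (τ := σ) (Q := σ \ {a}) ?_ ?_
    · have h3 := h2.symm.mono (I' := I) ?_ subset_rfl subset_rfl
      · rwa [show n + 1 + m + 1 + 0 = n + (m + 2) by omega] at h3
      · refine Set.union_subset (Set.union_subset (fun x hx => (ReachIn.mem hx).1) ?_)
          fun x hx => h.subset_left hx.1
        exact Set.insert_subset (h.subset_left ha) fun x hx => hx.1.1
    · rintro v ⟨_, w, hw, hvw⟩
      exact ⟨_, hvw, .nil hw rfl hw.1⟩
    · refine Set.disjoint_left.2 fun x hx hx' => ?_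
      rcases hx with hx | rfl | hx
      · exact (ReachIn.mem hx).2 hx'.1
      · exact hx'.2 rfl
      · exact hx.1.2 hx'.1
  · rintro v ⟨_, w, rfl, hvw⟩
    exact ⟨_, hvw, hm⟩
  · refine Set.disjoint_left.2 fun x hx hx' => ?_
    rcases hx' with rfl | hx'
    · exact (ReachIn.mem hx).2 ha
    · exact compIn_notMem_core hd hx hx'.2

/-- Trace a walk from d to τ backwards from τ. As σ is independent, its vertices stay in the core or
are σ-vertices exiting through the core, until a vertex outside both appears; its successor on the
walk is the required a. -/
theorem exists_exit (h : G.IsRooted X I σ τ) (h3 : ∀ a ∈ σ, ∀ b ∈ σ, ¬ G.Adj a b)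
    (hdI : d ∈ I) (hdσ : d ∉ σ) (hd : ¬ G.ReachIn (I \ σ) τ d) :
    ∃ a ∈ σ, ∃ e ∈ I, e ∉ σ ∧ G.Adj e a ∧ ¬ G.ReachIn (I \ σ) τ e ∧
      G.ReachIn (insert a (G.core I σ τ)) τ a := by
  by_contra hcon
  have key : ∀ v, G.ReachIn I τ v →
      v ∈ G.core I σ τ ∨ (v ∈ σ ∧ G.ReachIn (insert v (G.core I σ τ)) τ v) := by
    intro v hv
    induction hv with
    | @base v h1 h2 =>
      by_cases hvσ : v ∈ σ
      · exact .inr ⟨hvσ, .base (Set.mem_insert _ _) h2⟩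
      · exact .inl ⟨⟨h1, hvσ⟩, .base ⟨h1, hvσ⟩ h2⟩
    | @step v w h1 h2 _ ih =>
      rcases ih with ih | ⟨ih, ih'⟩
      · by_cases hvσ : v ∈ σ
        · refine .inr ⟨hvσ, .step (Set.mem_insert _ _) h2 (ih.2.self.mono ?_ fun _ _ h => h)⟩
          exact fun x hx => .inr hx
        · exact .inl (mem_core_of_adj ih h1 hvσ h2.symm)
      · by_cases hvσ : v ∈ σ
        · exact absurd h2 (h3 v hvσ w ih)
        · left
          refine ⟨⟨h1, hvσ⟩, ?_⟩
          by_contra hvn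
          exact hcon ⟨w, ih, v, h1, hvσ, h2, hvn, ih'⟩
  rcases key d (h.reach_right d hdI) with h1 | h1
  · exact hd h1.2
  · exact hdσ h1.1

/-! ### Short cycles at one end -/

/-- Of a and b, take the last on a walk to τ. It starts a path avoiding the other, and prefixing the
edge ab adds 1 to the length. -/
theorem closePaths_of_adj (h : G.IsRooted X I σ τ) (ha : a ∈ σ) (hb : b ∈ σ) (hab : G.Adj a b) :
    G.HasClosePaths I σ τ := by
  have key : ∀ a ∈ σ, ∀ b ∈ σ, G.Adj a b → G.ReachIn (I \ {b}) τ a → G.HasClosePaths I σ τ := by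
    intro a ha b hb hab hr
    obtain ⟨n, hn⟩ := hr.hasPathIn
    have h1 := hn.cons (u := b) (by simp) hab.symm
    refine ⟨n, hn.mono Set.sdiff_subset (by simpa using ha) subset_rfl, .inl (h1.mono ?_ ?_ subset_rfl)⟩
    · exact Set.insert_subset (h.subset_left hb) Set.sdiff_subset
    · simpa using hb
  rcases (h.reach_right a (h.subset_left ha)).exists_last (Q := {a, b}) with h1 | ⟨x, hx, h1⟩
  · exact absurd h1.mem.2 (by simp)
  · rcases hx with rfl | rfl
    · exact key x ha b hb hab (h1.mono (fun y hy => ⟨hy.1, fun hyb => hy.2 ⟨.inr hyb, fun h =>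
        hab.ne (h.symm.trans hyb)⟩⟩) fun _ _ h => h)
    · exact key x hb a ha hab.symm (h1.mono (fun y hy => ⟨hy.1, fun hyb => hy.2 ⟨.inl hyb, fun h =>
        hab.ne (hyb.symm.trans h)⟩⟩) fun _ _ h => h)

/-- If a reached τ without c, the last of a, b on such a walk would start a path avoiding c and the
other one; prefixing the detour through c adds 2. -/
theorem mem_behind_of_fourCycle (h : G.IsRooted X I σ τ) (hg : ¬ G.HasClosePaths I σ τ)
    (ha : a ∈ σ) (hb : b ∈ σ) (hab : a ≠ b) (hc : c ∈ I) (hca : G.Adj c a) (hcb : G.Adj c b) :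
    a ∈ G.behind I τ c := by
  refine ⟨h.subset_left ha, hca.ne', fun hr => ?_⟩
  have key : ∀ a ∈ σ, ∀ b ∈ σ, a ≠ b → G.Adj c a → G.Adj c b →
      ¬ G.ReachIn ((I \ {c}) \ {b}) τ a := by
    intro a ha b hb hab hca hcb hr
    obtain ⟨n, hn⟩ := hr.hasPathIn
    have h1 := hn.cons (u := c) (by simp) hca
    have h2 := h1.cons (u := b) (by simp [hcb.ne']) hcb.symm
    refine hg ⟨n, hn.mono (fun x hx => hx.1.1) (by simpa using ha) subset_rfl,
      .inr (h2.mono ?_ ?_ subset_rfl)⟩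
    · exact Set.insert_subset (h.subset_left hb) (Set.insert_subset hc fun x hx => hx.1.1)
    · simpa using hb
  rcases hr.exists_last (Q := {a, b}) with h1 | ⟨x, hx, h1⟩
  · exact absurd h1.mem.2 (by simp)
  · rcases hx with rfl | rfl
    · exact key x ha b hb hab hca hcb (h1.mono (fun y hy => ⟨hy.1, fun hyb => hy.2 ⟨.inr hyb, fun h =>
        hab (h.symm.trans hyb)⟩⟩) fun _ _ h => h)
    · exact key x hb a ha hab.symm hcb hca (h1.mono (fun y hy => ⟨hy.1, fun hyb =>
        hy.2 ⟨.inl hyb, fun h => hab (hyb.symm.trans h)⟩⟩) fun _ _ h => h)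

end IsRooted

end SimpleGraph

namespace SimpleGraph

variable {V : Type*} {G : SimpleGraph V}

/-! ### Very short paths and degree bounds -/

theorem HasPathIn.length_one {I σ τ : Set V} {u v : V} (hI : σ ⊆ I) (hu : u ∈ σ) (hvI : v ∈ I)
    (hv : v ∈ τ) (huv : G.Adj u v) : G.HasPathIn I σ τ 1 := by
  have h := (HasPathIn.nil (G := G) (I := {v}) (σ := {v}) rfl rfl hv).cons (u := u) huv.ne huv
  refine h.mono ?_ (by simpa using hu) subset_rfl
  exact Set.insert_subset (hI hu) (by simpa using hvI)

theorem HasPathIn.length_two {I σ τ : Set V} {u v w : V} (hI : σ ⊆ I) (hu : u ∈ σ) (hvI : v ∈ I)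
    (hwI : w ∈ I) (hw : w ∈ τ) (huv : G.Adj u v) (hvw : G.Adj v w) (huw : u ≠ w) :
    G.HasPathIn I σ τ 2 := by
  have h := ((HasPathIn.nil (G := G) (I := {w}) (σ := {w}) rfl rfl hw).cons (u := v)
    hvw.ne hvw).cons (u := u) (by simp [huv.ne, huw]) huv
  refine h.mono ?_ (by simpa using hu) subset_rfl
  exact Set.insert_subset (hI hu) (Set.insert_subset hvI (by simpa using hwI))

theorem rootedDegree_le (G : SimpleGraph V) (I σ τ : Set V) (v : V) :
    G.rootedDegree I σ τ v ≤ (G.neighborSet v ∩ I).ncard + 2 := by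
  unfold rootedDegree
  split_ifs <;> omega

theorem rootedDegree_le_of_notMem {I σ τ : Set V} {v : V} (h : v ∉ τ) :
    G.rootedDegree I σ τ v ≤ (G.neighborSet v ∩ I).ncard + 1 := by
  unfold rootedDegree
  rw [if_neg h]
  split_ifs <;> omega

theorem two_le_ncard [Finite V] {S : Set V} {a b : V} (ha : a ∈ S) (hb : b ∈ S) (hab : a ≠ b) :
    2 ≤ S.ncard :=
  (Set.one_lt_ncard (Set.toFinite _)).2 ⟨a, ha, b, hb, hab⟩

namespace IsRooted

variable {X I J σ τ : Set V} {a b c d v : V}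

theorem nonempty_left (h : G.IsRooted X I σ τ) (hI : I.Nonempty) : σ.Nonempty := by
  obtain ⟨v, hv⟩ := hI
  obtain ⟨x, hx, _⟩ := (h.reach_left v hv).exists_mem
  exact ⟨x, hx⟩

theorem nonempty_right (h : G.IsRooted X I σ τ) (hI : I.Nonempty) : τ.Nonempty :=
  h.symm.nonempty_left hI

theorem mem_of_nbrs_eq_empty [Finite V] (h : G.IsRooted X I σ τ) (hv : v ∈ I)
    (hn : ∀ w ∈ I, ¬ G.Adj v w) : v ∈ X ∧ v ∈ τ := by
  constructor
  · by_contra hX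
    have h1 := (h.three_le v hv hX).trans (G.rootedDegree_le I σ τ v)
    have h2 : G.neighborSet v ∩ I = ∅ :=
      Set.eq_empty_iff_forall_notMem.2 fun w hw => hn w hw.2 hw.1
    rw [h2, Set.ncard_empty] at h1
    omega
  · cases h.reach_right v hv with
    | base _ h2 => exact h2
    | step _ h2 h3 => exact absurd h2 (hn _ h3.mem)

theorem exists_adj [Finite V] (h : G.IsRooted X I σ τ) (hv : v ∈ I) (hX : v ∉ X) :
    ∃ w ∈ I, G.Adj v w := by
  by_contra hcon
  push Not at hcon
  exact hX (h.mem_of_nbrs_eq_empty hv hcon).1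

theorem two_le_nbrs (h : G.IsRooted X I σ τ) (hv : v ∈ I) (hX : v ∉ X) (hτ : v ∉ τ) :
    2 ≤ (G.neighborSet v ∩ I).ncard := by
  have := (h.three_le v hv hX).trans (rootedDegree_le_of_notMem hτ)
  omega

/-- The part behind c contains both a and b, so the degenerate outcome of the induction is
impossible. -/
theorem not_singleton_behind (h : G.IsRooted X I σ τ) (hg : ¬ G.HasClosePaths I σ τ)
    (ha : a ∈ σ) (hb : b ∈ σ) (hab : a ≠ b) (hc : c ∈ I) (hca : G.Adj c a) (hcb : G.Adj c b)
    (hR : G.HasClosePaths (G.behind I τ c) (σ ∩ G.behind I τ c)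
      (G.nbrsIn {c} (G.behind I τ c)) ∨ ∃ y ∈ X, G.behind I τ c = {y}) : False := by
  rcases hR with hR | ⟨y, _, hy⟩
  · exact hg (h.closePaths_of_behind hc hR)
  · have h1 := h.mem_behind_of_fourCycle hg ha hb hab hc hca hcb
    have h2 := h.mem_behind_of_fourCycle hg hb ha hab.symm hc hcb hca
    rw [hy] at h1 h2
    exact hab (h1.trans h2.symm)

/-- A one-vertex component would have neighbours both in {a} and in σ \ {a}, against `h4`. -/
theorem not_singleton_compIn [Finite V] (h : G.IsRooted X I σ τ) (hg : ¬ G.HasClosePaths I σ τ)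
    (h4 : ∀ v ∈ I, v ∉ σ → ∀ a ∈ σ, ∀ b ∈ σ, G.Adj v a → G.Adj v b → a = b)
    (ha : a ∈ σ) (hdI : d ∈ I) (hdσ : d ∉ σ) (had : G.Adj d a)
    (hd : ¬ G.ReachIn (I \ σ) τ d) (hexit : G.ReachIn (insert a (G.core I σ τ)) τ a)
    (hD : G.HasClosePaths (G.compIn I σ d) (G.nbrsIn (σ \ {a}) (G.compIn I σ d))
      (G.nbrsIn {a} (G.compIn I σ d)) ∨ ∃ y ∈ X, G.compIn I σ d = {y}) : False := by
  rcases hD with hD | ⟨y, _, hy⟩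
  · exact hg (h.closePaths_of_compIn ha hd hexit hD)
  · have hr := h.rooted_compIn h4 ha hdI hdσ had hd
    obtain ⟨x, ⟨hx, w, hw, hxw⟩, _⟩ := (hr.reach_left y (hy ▸ rfl)).exists_mem
    have hdD : d ∈ G.compIn I σ d := ReachIn.base (S := I \ σ) ⟨hdI, hdσ⟩ rfl
    rw [hy] at hx hdD
    rw [hx.trans hdD.symm] at hxw
    exact hw.2 (h4 d hdI hdσ w hw.1 a ha hxw had)

theorem ncard_behind_lt [Finite V] (hc : c ∈ I) : (G.behind I τ c).ncard < I.ncard :=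
  Set.ncard_lt_ncard ⟨fun _ hx => hx.1, fun hs => (hs hc).2.1 rfl⟩ (Set.toFinite _)

theorem ncard_compIn_lt [Finite V] (h : G.IsRooted X I σ τ) (ha : a ∈ σ) :
    (G.compIn I σ d).ncard < I.ncard :=
  Set.ncard_lt_ncard ⟨fun _ hx => (ReachIn.mem hx).1,
    fun hs => (ReachIn.mem (hs (h.subset_left ha))).2 ha⟩ (Set.toFinite _)

theorem ncard_core_lt [Finite V] (h : G.IsRooted X I σ τ) (ha : a ∈ σ) :
    (G.core I σ τ).ncard < I.ncard :=
  Set.ncard_lt_ncard ⟨fun _ hx => hx.1.1,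
    fun hs => (hs (h.subset_left ha)).1.2 ha⟩ (Set.toFinite _)

theorem ncard_inter_le [Finite V] (hJ : J ⊆ I) : (X ∩ J).ncard ≤ (X ∩ I).ncard :=
  Set.ncard_le_ncard (Set.inter_subset_inter_right _ hJ) (Set.toFinite _)

/-! ### At most one exceptional vertex -/

/-- A rooted graph with at most one exceptional vertex has close paths, unless this vertex is
all of it. -/
theorem closePaths_or_singleton [Finite V] (h : G.IsRooted X I σ τ) (hI : I.Nonempty)
    (hX : (X ∩ I).ncard ≤ 1) : G.HasClosePaths I σ τ ∨ ∃ y ∈ X, I = {y} := by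
  induction hn : I.ncard using Nat.strong_induction_on generalizing X I σ τ with
  | _ n ih =>
  subst hn
  by_contra hcon
  push Not at hcon
  obtain ⟨hg, hs⟩ := hcon
  have h3 : ∀ a ∈ σ, ∀ b ∈ σ, ¬ G.Adj a b := fun a ha b hb hab =>
    hg (h.closePaths_of_adj ha hb hab)
  have h4 : ∀ v ∈ I, v ∉ σ → ∀ a ∈ σ, ∀ b ∈ σ, G.Adj v a → G.Adj v b → a = b := by
    intro v hv _ a ha b hb hva hvb
    by_contra hab
    refine h.not_singleton_behind hg ha hb hab hv hva hvb ?_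
    exact ih _ (ncard_behind_lt hv) (h.rooted_behind hv)
      ⟨a, h.mem_behind_of_fourCycle hg ha hb hab hv hva hvb⟩
      ((ncard_inter_le fun _ hx => hx.1).trans hX) rfl
  have hD : ∀ d ∈ I, d ∉ σ → d ∈ G.core I σ τ := by
    intro d hdI hdσ
    refine ⟨⟨hdI, hdσ⟩, ?_⟩
    by_contra hd
    obtain ⟨a, ha, e, heI, heσ, hea, he, hexit⟩ := h.exists_exit h3 hdI hdσ hd
    refine h.not_singleton_compIn hg h4 ha heI heσ hea he hexit ?_
    exact ih _ (h.ncard_compIn_lt ha) (h.rooted_compIn h4 ha heI heσ hea he)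
      ⟨e, ReachIn.base (S := I \ σ) ⟨heI, heσ⟩ rfl⟩
      ((ncard_inter_le fun x hx => (ReachIn.mem hx).1).trans hX) rfl
  obtain ⟨a, ha⟩ := h.nonempty_left hI
  -- By `hD` the core is I \ σ. If it is empty, I = σ is independent, so every vertex is isolated
  -- and hence exceptional; only one can exist.
  rcases (G.core I σ τ).eq_empty_or_nonempty with hC | hC
  · have hIσ : ∀ x ∈ I, x ∈ σ := fun x hx => by
      by_contra hxσ
      have := hD x hx hxσ
      rw [hC] at this
      exact this
    have hIX : ∀ x ∈ I, x ∈ X := fun x hx =>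
      (h.mem_of_nbrs_eq_empty hx fun w hw => h3 x (hIσ x hx) w (hIσ w hw)).1
    refine hs a (hIX a (h.subset_left ha)) ?_
    refine Set.eq_singleton_iff_unique_mem.2 ⟨h.subset_left ha, fun x hx => ?_⟩
    by_contra hxa
    have := two_le_ncard (S := X ∩ I) ⟨hIX x hx, hx⟩ ⟨hIX a (h.subset_left ha), h.subset_left ha⟩
      hxa
    omega
  · have hr := h.rooted_core h4
    rcases ih _ (h.ncard_core_lt ha) hr hC
      ((ncard_inter_le fun x hx => hx.1.1).trans hX) rfl with h1 | ⟨y, hyX, hy⟩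
    · exact hg (h.closePaths_of_core h1)
    -- The core is one exceptional vertex t, so a is not exceptional and has no neighbour in I but
    -- t. Degree three forces a into τ, and the paths a and a, t have lengths 0 and 1.
    · obtain ⟨t, ht⟩ := hr.nonempty_right hC
      have hty : t = y := by
        have := ht.2
        rwa [hy] at this
      subst hty
      have htI : t ∈ I := ht.2.1.1
      have haX : a ∉ X := fun haX => by
        have := two_le_ncard (S := X ∩ I) ⟨haX, h.subset_left ha⟩ ⟨hyX, htI⟩
          fun hat => ht.2.1.2 (hat ▸ ha)
        omega
      have hn : ∀ w ∈ I, G.Adj a w → w = t := fun w hw haw => by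
        have := hD w hw fun hwσ => h3 a ha w hwσ haw
        rwa [hy] at this
      have haτ : a ∈ τ := by
        by_contra haτ
        have h1 := h.two_le_nbrs (h.subset_left ha) haX haτ
        have h2 : (G.neighborSet a ∩ I).ncard ≤ 1 := (Set.ncard_le_one (Set.toFinite _)).2
          fun w hw w' hw' => (hn w hw.2 hw.1).trans (hn w' hw'.2 hw'.1).symm
        omega
      obtain ⟨w, hw, haw⟩ := h.exists_adj (h.subset_left ha) haX
      refine hg ⟨0, .nil (h.subset_left ha) ha haτ, .inl ?_⟩
      exact .length_one h.subset_left ha htI ht.1 (hn w hw haw ▸ haw)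

end IsRooted

/-! ### Two exceptional vertices -/

/-- Every rooted graph with fewer than `n` vertices, at most two of them exceptional, and at least
two edges at either root has close paths or is an extension of a four-cycle. -/
def SmallCase (G : SimpleGraph V) (n : ℕ) : Prop :=
  ∀ X I σ τ : Set V, I.ncard < n → G.IsRooted X I σ τ → (X ∩ I).ncard ≤ 2 → 2 ≤ σ.ncard →
    2 ≤ τ.ncard → ¬ G.HasClosePaths I σ τ → σ = τ ∧ σ.ncard = 2

theorem SmallCase.mono {m n : ℕ} (h : G.SmallCase n) (hmn : m ≤ n) : G.SmallCase m :=
  fun X I σ τ hI => h X I σ τ (hI.trans_le hmn)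

namespace IsRooted

variable {X I J σ τ : Set V} {a b c d v : V}

theorem two_le_behind [Finite V] (h : G.IsRooted X I σ τ) (hg : ¬ G.HasClosePaths I σ τ)
    (ha : a ∈ σ) (hb : b ∈ σ) (hab : a ≠ b) (hc : c ∈ I) (hca : G.Adj c a) (hcb : G.Adj c b) :
    2 ≤ (X ∩ G.behind I τ c).ncard := by
  by_contra hlt
  exact h.not_singleton_behind hg ha hb hab hc hca hcb
    ((h.rooted_behind hc).closePaths_or_singleton
      ⟨a, h.mem_behind_of_fourCycle hg ha hb hab hc hca hcb⟩ (by omega))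

theorem two_le_compIn [Finite V] (h : G.IsRooted X I σ τ) (hg : ¬ G.HasClosePaths I σ τ)
    (h4 : ∀ v ∈ I, v ∉ σ → ∀ a ∈ σ, ∀ b ∈ σ, G.Adj v a → G.Adj v b → a = b)
    (ha : a ∈ σ) (hdI : d ∈ I) (hdσ : d ∉ σ) (had : G.Adj d a)
    (hd : ¬ G.ReachIn (I \ σ) τ d) (hexit : G.ReachIn (insert a (G.core I σ τ)) τ a) :
    2 ≤ (X ∩ G.compIn I σ d).ncard := by
  by_contra hlt
  exact h.not_singleton_compIn hg h4 ha hdI hdσ had hd hexit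
    ((h.rooted_compIn h4 ha hdI hdσ had hd).closePaths_or_singleton
      ⟨d, ReachIn.base (S := I \ σ) ⟨hdI, hdσ⟩ rfl⟩ (by omega))

theorem mem_of_two_le [Finite V] (hJ : J ⊆ I) (hX : (X ∩ I).ncard ≤ 2) (h2 : 2 ≤ (X ∩ J).ncard) :
    ∀ x ∈ X, x ∈ I → x ∈ J := by
  have := Set.eq_of_subset_of_ncard_le (Set.inter_subset_inter_right X hJ) (by omega)
    (Set.toFinite _)
  intro x hx hxI
  have h1 : x ∈ X ∩ I := ⟨hx, hxI⟩
  rw [← this] at h1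
  exact h1.2

/-- If c had neighbours a ≠ b in σ, the part behind c would contain all of X. Either σ also meets
the side C of τ, and a smaller rooted graph on C, c, a contradicts the induction; or c cuts σ off
from a part without exceptional vertices, which yields close paths. -/
theorem eq_of_fourCycle [Finite V] (h : G.IsRooted X I σ τ) (ih : G.SmallCase I.ncard)
    (hX : (X ∩ I).ncard ≤ 2) (hτ2 : 2 ≤ τ.ncard) (hg : ¬ G.HasClosePaths I σ τ)
    (hc : c ∈ I) (hcσ : c ∉ σ) (ha : a ∈ σ) (hb : b ∈ σ) (hca : G.Adj c a) (hcb : G.Adj c b) :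
    a = b := by
  by_contra hab
  have haR := h.mem_behind_of_fourCycle hg ha hb hab hc hca hcb
  have hbR := h.mem_behind_of_fourCycle hg hb ha (Ne.symm hab) hc hcb hca
  have hXR := mem_of_two_le (fun x hx => hx.1) hX (h.two_le_behind hg ha hb hab hc hca hcb)
  set C : Set V := {v | v ∈ I \ {c} ∧ G.ReachIn (I \ {c}) τ v}
  by_cases hσC : ∃ e ∈ σ, e ∈ C
  · obtain ⟨e, heσ, heC⟩ := hσC
    have haC : a ∉ C := fun h => haR.2.2 h.2
    have hbC : b ∉ C := fun h => hbR.2.2 h.2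
    have hCI : ∀ x ∈ C, x ∈ I := fun x hx => hx.1.1
    have hCa : ∀ x ∈ C, ∀ y ∈ I, G.Adj x y → y = c ∨ y ∈ C := by
      intro x hx y hy hxy
      by_cases hyc : y = c
      · exact .inl hyc
      · exact .inr ⟨⟨hy, hyc⟩, .step ⟨hy, hyc⟩ hxy.symm hx.2⟩
    have hτJ : ∀ x ∈ τ, x ∈ insert c C := by
      intro x hx
      by_cases hxc : x = c
      · exact .inl hxc
      · exact .inr ⟨⟨h.subset_right hx, hxc⟩, .base ⟨h.subset_right hx, hxc⟩ hx⟩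
    have hcR : G.ReachIn (insert c C) τ c := by
      refine (h.reach_diff_behind hc).mono (fun x hx => ?_) fun _ _ h => h
      by_cases hxc : x = c
      · exact .inl hxc
      · refine .inr ⟨⟨hx.1, hxc⟩, ?_⟩
        by_contra hn
        exact hx.2 ⟨hx.1, hxc, hn⟩
    set J : Set V := insert a (insert c C)
    have hJI : J ⊆ I := Set.insert_subset (h.subset_left ha) (Set.insert_subset hc hCI)
    have haJ : a ∈ J := .inl rfl
    have hcJ : c ∈ J := .inr (.inl rfl)
    have hCJ : C ⊆ J := fun x hx => .inr (.inr hx)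
    -- Everything behind c except a is discarded. No vertex of X lies in C, so both exceptional
    -- places are free for a and c, which may have lost neighbours.
    have hr : G.IsRooted {a, c} J (σ ∩ J) τ := by
      refine ⟨Set.inter_subset_right, fun x hx => .inr (hτJ x hx), ?_, ?_, ?_, ?_⟩
      · have h1 : G.ReachIn J (σ ∩ J) c := .step hcJ hca (.base haJ ⟨ha, haJ⟩)
        rintro v (rfl | rfl | hv)
        · exact .base haJ ⟨ha, haJ⟩
        · exact h1
        · have h2 : G.ReachIn (I ∩ C) ((σ ∩ J) ∪ {x | G.Adj x c}) v := by
            refine (h.reach_left v (hCI v hv)).restrict (J := C) hv ?_ ?_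
            · exact fun x hx _ hxσ => .inl ⟨hxσ, hCJ hx⟩
            · intro x hx _ y hy hyC hxy
              exact .inr ((hCa x hx y hy hxy).resolve_right hyC ▸ hxy)
          refine (h2.mono (T := J) (fun x hx => hCJ hx.2) fun _ _ h => h).trans ?_
          rintro p (hp | hp) hpJ
          · exact .base hpJ hp
          · exact .step hpJ hp h1
      · have h1 : G.ReachIn J τ c := hcR.mono (Set.subset_insert _ _) fun _ _ h => h
        rintro v (rfl | rfl | hv)
        · exact .step haJ hca.symm h1
        · exact h1
        · exact hv.2.self.mono hCJ fun _ _ h => h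
      · intro v hv u hu huv
        rcases hu with rfl | rfl | hu
        · exact .base ⟨haJ, huv⟩ (.inl ⟨ha, haJ⟩)
        · by_cases hva : v = a
          · subst hva
            refine hcR.mono (fun x hx => ⟨.inr hx, ?_⟩) fun _ _ h => .inr h
            rintro rfl
            exact hx.elim (fun h => hca.ne h.symm) haC
          · exact .step ⟨hcJ, huv⟩ hca (.base ⟨haJ, Ne.symm hva⟩ (.inl ⟨ha, haJ⟩))
        · by_cases hva : v = a
          · subst hva
            refine hu.2.self.mono (fun x hx => ⟨hCJ hx, ?_⟩) fun _ _ h => .inr h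
            rintro rfl
            exact haC hx
          · by_cases hvc : v = c
            · subst hvc
              exact hu.2.self.mono (fun x hx => ⟨hCJ hx, hx.1.2⟩) fun _ _ h => .inr h
            · have h2 : G.ReachIn (I \ {v} ∩ C) ((σ ∩ J ∪ τ) ∪ {x | G.Adj x c}) u := by
                refine (h.reach_diff v (hJI hv) u (hCI u hu) huv).restrict (J := C) hu ?_ ?_
                · exact fun x hx _ hx' => .inl (hx'.imp (⟨·, hCJ hx⟩) id)
                · intro x hx _ y hy hyC hxy
                  exact .inr ((hCa x hx y hy.1 hxy).resolve_right hyC ▸ hxy)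
              refine (h2.mono (T := J \ {v}) (fun x hx => ⟨hCJ hx.2, hx.1.2⟩)
                fun _ _ h => h).trans ?_
              rintro p (hp | hp) hpJ
              · exact .base hpJ hp
              · exact .step hpJ hp (.step ⟨hcJ, Ne.symm hvc⟩ hca
                  (.base ⟨haJ, Ne.symm hva⟩ (.inl ⟨ha, haJ⟩)))
      · rintro v (rfl | rfl | hv) hvX
        · exact absurd (.inl rfl) hvX
        · exact absurd (.inr rfl) hvX
        · have hvX' : v ∉ X := fun hvX' => (hXR v hvX' (hCI v hv)).2.2 hv.2
          refine (h.three_le v (hCI v hv) hvX').trans ?_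
          have h1 : (G.neighborSet v ∩ I).ncard ≤ (G.neighborSet v ∩ J).ncard :=
            ncard_nbrs_mono fun w hw hvw =>
              (hCa v hv w hw hvw).elim (fun h => h ▸ hcJ) fun h => hCJ h
          unfold rootedDegree
          by_cases hs : v ∈ σ
          · rw [if_pos hs, if_pos (show v ∈ σ ∩ J from ⟨hs, hCJ hv⟩)]
            omega
          · rw [if_neg hs, if_neg (show v ∉ σ ∩ J from fun h => hs h.1)]
            omega
    have hlt : J.ncard < I.ncard := by
      refine Set.ncard_lt_ncard ⟨hJI, fun hs => ?_⟩ (Set.toFinite _)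
      rcases hs (h.subset_left hb) with h1 | h1 | h1
      · exact hab h1.symm
      · exact hcb.ne h1.symm
      · exact hbC h1
    have hE : (({a, c} : Set V) ∩ J).ncard ≤ 2 :=
      (Set.ncard_le_ncard Set.inter_subset_left (Set.toFinite _)).trans
        ((Set.ncard_insert_le _ _).trans (by rw [Set.ncard_singleton]))
    have hσ2 : 2 ≤ (σ ∩ J).ncard :=
      two_le_ncard ⟨ha, haJ⟩ ⟨heσ, hCJ heC⟩ fun hae => haC (hae ▸ heC)
    have hg' : ¬ G.HasClosePaths J (σ ∩ J) τ := fun hg' =>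
      hg (hg'.lift 0 fun n hn => hn.mono hJI Set.inter_subset_left subset_rfl)
    have hmem : a ∈ σ ∩ J := ⟨ha, haJ⟩
    -- The induction gives σ ∩ J = τ, although a lies behind c and hence not in τ.
    rw [(ih _ _ _ _ hlt hr hE hσ2 hτ2 hg').1] at hmem
    exact notMem_of_behind haR hmem
  · have hr := h.symm.rooted_behind hc
    obtain ⟨t, ht, htc⟩ := Set.exists_ne_of_one_lt_ncard (s := τ) (by omega) c
    have htS : t ∈ G.behind I σ c := by
      refine ⟨h.subset_right ht, htc, fun hts => ?_⟩
      obtain ⟨p, hp, hp'⟩ := hts.exists_common (.base hts.mem ht)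
      exact hσC ⟨p, hp, hp'.mem, hp'⟩
    have hE : ∀ x ∈ X, x ∉ G.behind I σ c := by
      intro x hx hx'
      have hxR := hXR x hx hx'.1
      rcases (h.reach_diff c hc x hx'.1 hx'.2.1).union with h1 | h1
      · exact hx'.2.2 h1
      · exact hxR.2.2 h1
    have hE' : X ∩ G.behind I σ c = ∅ :=
      Set.eq_empty_iff_forall_notMem.2 fun x hx => hE x hx.1 hx.2
    rcases hr.closePaths_or_singleton ⟨t, htS⟩ (by rw [hE', Set.ncard_empty]; omega)
      with h1 | ⟨y, hyX, hy⟩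
    · exact hg (h.symm.closePaths_of_behind hc h1).symm
    · exact hE y hyX (hy ▸ rfl)

/-- The case of a root with a single neighbour. -/
theorem adj_of_singleton [Finite V] (h : G.IsRooted X I σ {b}) (ih : G.SmallCase I.ncard)
    (hX : (X ∩ I).ncard ≤ 2) (hσ2 : 2 ≤ σ.ncard) (hb : b ∉ σ)
    (hg : ¬ G.HasClosePaths I σ {b}) : (∀ x ∈ σ, G.Adj x b) ∧ σ.ncard = 2 := by
  have hbI : b ∈ I := h.subset_right rfl
  have hmem : ∀ x ∈ I, x ≠ b → x ∈ G.behind I {b} b := by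
    intro x hx hxb
    refine ⟨hx, hxb, fun hr => ?_⟩
    obtain ⟨y, hy, hy'⟩ := hr.exists_mem
    exact hy'.2 hy
  have hr := h.rooted_behind hbI
  have hσ : σ ∩ G.behind I {b} b = σ :=
    Set.inter_eq_left.2 fun x hx => hmem x (h.subset_left hx) fun hxb => hb (hxb ▸ hx)
  have hg' := fun hg' => hg (h.closePaths_of_behind hbI hg')
  rw [hσ] at hr hg'
  have hE : (X ∩ G.behind I {b} b).ncard ≤ 2 := (ncard_inter_le fun x hx => hx.1).trans hX
  -- The root is moved to b. If b is exceptional, at most one exceptional vertex remains, and σ has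
  -- too many elements for the singleton case.
  by_cases hbX : b ∈ X
  · exfalso
    obtain ⟨x, hx, y, hy, hxy⟩ := (Set.one_lt_ncard (Set.toFinite _)).1 hσ2
    have hlt : (X ∩ G.behind I {b} b).ncard < (X ∩ I).ncard :=
      Set.ncard_lt_ncard ⟨fun x hx => ⟨hx.1, hx.2.1⟩, fun hs => (hs ⟨hbX, hbI⟩).2.2.1 rfl⟩
        (Set.toFinite _)
    rcases hr.closePaths_or_singleton ⟨x, hr.subset_left hx⟩ (by omega) with h1 | ⟨z, _, hz⟩
    · exact hg' h1
    · have hx' := hr.subset_left hx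
      have hy' := hr.subset_left hy
      rw [hz] at hx' hy'
      exact hxy (hx'.trans hy'.symm)
  · have h2 : 2 ≤ (G.nbrsIn {b} (G.behind I {b} b)).ncard := by
      refine (h.symm.two_le_nbrs hbI hbX hb).trans (Set.ncard_le_ncard ?_ (Set.toFinite _))
      intro w hw
      exact ⟨hmem w hw.2 hw.1.ne', b, rfl, hw.1.symm⟩
    obtain ⟨h3, h4⟩ := ih _ _ _ _ (ncard_behind_lt hbI) hr hE hσ2 h2 hg'
    refine ⟨fun x hx => ?_, h4⟩
    rw [h3] at hx
    obtain ⟨_, w, rfl, hxw⟩ := hx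
    exact hxw

/-- Here the core is all of I \ σ. An empty core gives the obstruction itself. Otherwise the
obstruction in the contracted graph pulls back to paths of lengths 0 and 1, or 0 and 2, in the
original. -/
theorem eq_of_core [Finite V] (h : G.IsRooted X I σ τ) (ih : G.SmallCase I.ncard)
    (hX : (X ∩ I).ncard ≤ 2) (hσ2 : 2 ≤ σ.ncard) (hτ2 : 2 ≤ τ.ncard)
    (hg : ¬ G.HasClosePaths I σ τ)
    (h4 : ∀ v ∈ I, v ∉ σ → ∀ a ∈ σ, ∀ b ∈ σ, G.Adj v a → G.Adj v b → a = b)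
    (hD : ∀ d ∈ I, d ∉ σ → G.ReachIn (I \ σ) τ d) : σ = τ ∧ σ.ncard = 2 := by
  have h3 : ∀ a ∈ σ, ∀ b ∈ σ, ¬ G.Adj a b := fun a ha b hb hab =>
    hg (h.closePaths_of_adj ha hb hab)
  have hmem : ∀ x ∈ I, x ∉ σ → x ∈ G.core I σ τ := fun x hx hxσ => ⟨⟨hx, hxσ⟩, hD x hx hxσ⟩
  have hnbr : ∀ a ∈ σ, ∀ w ∈ I, G.Adj a w → w ∈ G.core I σ τ := fun a ha w hw haw =>
    hmem w hw fun hwσ => h3 a ha w hwσ haw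
  obtain ⟨a, ha, b, hb, hab⟩ := (Set.one_lt_ncard (Set.toFinite _)).1 hσ2
  rcases (G.core I σ τ).eq_empty_or_nonempty with hC | hC
  · have hall : ∀ x ∈ σ, x ∈ X ∧ x ∈ τ := by
      intro x hx
      refine h.mem_of_nbrs_eq_empty (h.subset_left hx) fun w hw hxw => ?_
      have := hnbr x hx w hw hxw
      rw [hC] at this
      exact this
    refine ⟨Set.Subset.antisymm (fun x hx => (hall x hx).2) fun x hx => ?_, ?_⟩
    · by_contra hxσ
      have := hmem x (h.subset_right hx) hxσ
      rw [hC] at this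
      exact this
    · have := Set.ncard_le_ncard (s := σ) (t := X ∩ I)
        (fun x hx => ⟨(hall x hx).1, h.subset_left hx⟩) (Set.toFinite _)
      omega
  exfalso
  have hr := h.rooted_core h4
  have hg' := fun hg' => hg (h.closePaths_of_core hg')
  have hE : (X ∩ G.core I σ τ).ncard ≤ 2 := (ncard_inter_le fun x hx => hx.1.1).trans hX
  have hlt := h.ncard_core_lt ha
  by_cases hX1 : (X ∩ G.core I σ τ).ncard ≤ 1
  · rcases hr.closePaths_or_singleton hC hX1 with h1 | ⟨y, hyX, hy⟩
    · exact hg' h1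
    obtain ⟨u, hu, w, hw, huw⟩ := hr.nonempty_left hC
    obtain ⟨t, ht, htC⟩ := hr.nonempty_right hC
    have hut : u = t := by
      rw [hy] at hu htC
      exact hu.trans htC.symm
    subst hut
    obtain ⟨w', hw', hne⟩ := Set.exists_ne_of_one_lt_ncard (s := σ) (by omega) w
    have hw'τ : w' ∈ τ := by
      -- The single core vertex is already adjacent to w, so by `h4` the vertex w' is isolated.
      refine (h.mem_of_nbrs_eq_empty (h.subset_left hw') fun z hz hz' => ?_).2
      have hzC := hnbr w' hw' z hz hz'
      rw [hy] at hzC hu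
      rw [hzC.trans hu.symm] at hz'
      exact hne (h4 u htC.1.1 htC.1.2 w' hw' w hw hz'.symm huw)
    exact hg ⟨0, .nil (h.subset_left hw') hw' hw'τ,
      .inl (.length_one h.subset_left hw htC.1.1 ht huw.symm)⟩
  have hXC := mem_of_two_le (fun x hx => hx.1.1) hX (show 2 ≤ (X ∩ G.core I σ τ).ncard by omega)
  have hσX : ∀ x ∈ σ, x ∉ X := fun x hx hxX => (hXC x hxX (h.subset_left hx)).1.2 hx
  have hσ'2 : 2 ≤ (G.nbrsIn σ (G.core I σ τ)).ncard := by
    obtain ⟨u, hu, hau⟩ := h.exists_adj (h.subset_left ha) (hσX a ha)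
    obtain ⟨w, hw, hbw⟩ := h.exists_adj (h.subset_left hb) (hσX b hb)
    have huC := hnbr a ha u hu hau
    refine two_le_ncard ⟨huC, a, ha, hau.symm⟩ ⟨hnbr b hb w hw hbw, b, hb, hbw.symm⟩ ?_
    rintro rfl
    exact hab (h4 u hu huC.1.2 a ha b hb hau.symm hbw.symm)
  by_cases hτ'2 : 2 ≤ (τ ∩ G.core I σ τ).ncard
  · obtain ⟨h5, h6⟩ := ih _ _ _ _ hlt hr hE hσ'2 hτ'2 hg'
    -- Otherwise a and b would each have two neighbours in the core, disjoint by `h4`: four elements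
    -- in a set of size two.
    have hK : ∃ x ∈ σ, x ∈ τ := by
      by_contra hK
      push Not at hK
      have h7 : (G.neighborSet a ∩ I) ∪ (G.neighborSet b ∩ I) ⊆ G.nbrsIn σ (G.core I σ τ) := by
        rintro w (hw | hw)
        · exact ⟨hnbr a ha w hw.2 hw.1, a, ha, hw.1.symm⟩
        · exact ⟨hnbr b hb w hw.2 hw.1, b, hb, hw.1.symm⟩
      have h8 := Set.ncard_le_ncard h7 (Set.toFinite _)
      rw [Set.ncard_union_eq] at h8
      · have := h.two_le_nbrs (h.subset_left ha) (hσX a ha) (hK a ha)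
        have := h.two_le_nbrs (h.subset_left hb) (hσX b hb) (hK b hb)
        omega
      · refine Set.disjoint_left.2 fun w hw hw' => ?_
        exact hab (h4 w hw.2 (hnbr a ha w hw.2 hw.1).1.2 a ha b hb hw.1.symm hw'.1.symm)
    obtain ⟨x, hx, hxτ⟩ := hK
    obtain ⟨u, hu⟩ := hr.nonempty_left hC
    have hu' := hu
    rw [h5] at hu'
    obtain ⟨huC, w, hw, huw⟩ := hu
    exact hg ⟨0, .nil (h.subset_left hx) hx hxτ,
      .inl (.length_one h.subset_left hw huC.1.1 hu'.1 huw.symm)⟩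
  · have hK : ∃ x ∈ σ, x ∈ τ := by
      by_contra hK
      push Not at hK
      have : τ ∩ G.core I σ τ = τ := Set.inter_eq_left.2 fun x hx =>
        hmem x (h.subset_right hx) fun hxσ => hK x hxσ hx
      rw [this] at hτ'2
      exact hτ'2 hτ2
    obtain ⟨x, hx, hxτ⟩ := hK
    have hnil : G.HasPathIn I σ τ 0 := .nil (h.subset_left hx) hx hxτ
    obtain ⟨t, ht⟩ := hr.nonempty_right hC
    have hτ1 : τ ∩ G.core I σ τ = {t} := by
      refine Set.eq_singleton_iff_unique_mem.2 ⟨ht, fun s hs => ?_⟩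
      by_contra hst
      exact hτ'2 (two_le_ncard hs ht hst)
    rw [hτ1] at hr hg'
    have htσ : t ∉ G.nbrsIn σ (G.core I σ τ) := by
      rintro ⟨htC, w, hw, htw⟩
      exact hg ⟨0, hnil, .inl (.length_one h.subset_left hw htC.1.1 ht.1 htw.symm)⟩
    obtain ⟨h5, _⟩ := hr.adj_of_singleton (ih.mono hlt.le) hE hσ'2 htσ hg'
    obtain ⟨u, hu⟩ := hr.nonempty_left hC
    have hut := h5 u hu
    obtain ⟨huC, w, hw, huw⟩ := hu
    -- Length 0 at x in σ ∩ τ, and length 2 along w, u, t.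
    refine hg ⟨0, hnil, .inr (.length_two h.subset_left hw huC.1.1 ht.2.1.1 ht.1 huw.symm hut ?_)⟩
    rintro rfl
    exact ht.2.1.2 hw

/-- A component missing τ must contain all exceptional vertices. The core then has none, so if
nonempty it yields close paths; hence it is empty. -/
theorem subset_of_not_reachIn [Finite V] (h : G.IsRooted X I σ τ)
    (hX : (X ∩ I).ncard ≤ 2) (hg : ¬ G.HasClosePaths I σ τ)
    (h4 : ∀ v ∈ I, v ∉ σ → ∀ a ∈ σ, ∀ b ∈ σ, G.Adj v a → G.Adj v b → a = b)
    (hdI : d ∈ I) (hdσ : d ∉ σ) (hd : ¬ G.ReachIn (I \ σ) τ d) :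
    τ ⊆ σ ∧ ∀ x ∈ σ, x ∉ X := by
  have h3 : ∀ a ∈ σ, ∀ b ∈ σ, ¬ G.Adj a b := fun a ha b hb hab =>
    hg (h.closePaths_of_adj ha hb hab)
  obtain ⟨a, ha, e, heI, heσ, hea, he, hexit⟩ := h.exists_exit h3 hdI hdσ hd
  have hXD := mem_of_two_le (fun x hx => (ReachIn.mem hx).1) hX
    (h.two_le_compIn hg h4 ha heI heσ hea he hexit)
  refine ⟨fun t ht => ?_, fun x hx hxX => (ReachIn.mem (hXD x hxX (h.subset_left hx))).2 hx⟩
  by_contra htσ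
  have htC : t ∈ G.core I σ τ :=
    ⟨⟨h.subset_right ht, htσ⟩, .base ⟨h.subset_right ht, htσ⟩ ht⟩
  have hE : ∀ x ∈ X, x ∉ G.core I σ τ := fun x hx hxC =>
    compIn_notMem_core he (hXD x hx hxC.1.1) hxC.2
  have hE' : X ∩ G.core I σ τ = ∅ :=
    Set.eq_empty_iff_forall_notMem.2 fun x hx => hE x hx.1 hx.2
  rcases (h.rooted_core h4).closePaths_or_singleton ⟨t, htC⟩
    (by rw [hE', Set.ncard_empty]; omega) with h1 | ⟨y, hyX, hy⟩
  · exact hg (h.closePaths_of_core h1)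
  · exact hE y hyX (hy ▸ rfl)

/-- With σ = τ every component of I \ σ misses τ and must contain both exceptional vertices, so
there is only one. If σ had three elements, the obstruction in that component would produce paths of
lengths 3 and 4. -/
theorem ncard_eq_two_of_eq [Finite V] (h : G.IsRooted X I σ σ) (ih : G.SmallCase I.ncard)
    (hX : (X ∩ I).ncard ≤ 2) (hσ2 : 2 ≤ σ.ncard) (hg : ¬ G.HasClosePaths I σ σ)
    (h4 : ∀ v ∈ I, v ∉ σ → ∀ a ∈ σ, ∀ b ∈ σ, G.Adj v a → G.Adj v b → a = b)
    (hσX : ∀ x ∈ σ, x ∉ X) : σ.ncard = 2 := by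
  by_contra hne
  obtain ⟨a, b, c, ha, hb, hc, hab, hac, hbc⟩ :=
    (Set.two_lt_ncard_iff (s := σ) (Set.toFinite _)).1 (by omega)
  have h3 : ∀ a ∈ σ, ∀ b ∈ σ, ¬ G.Adj a b := fun a ha b hb hab =>
    hg (h.closePaths_of_adj ha hb hab)
  have hnr : ∀ d, ¬ G.ReachIn (I \ σ) σ d := by
    intro d hd
    obtain ⟨x, hx, hx'⟩ := hd.exists_mem
    exact hx'.2 hx
  have hnbr : ∀ x ∈ σ, ∃ u ∈ I, u ∉ σ ∧ G.Adj u x := by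
    intro x hx
    obtain ⟨u, hu, hxu⟩ := h.exists_adj (h.subset_left hx) (hσX x hx)
    exact ⟨u, hu, fun huσ => h3 x hx u huσ hxu, hxu.symm⟩
  have hcomp : ∀ x ∈ σ, ∀ u ∈ I, u ∉ σ → G.Adj u x → 2 ≤ (X ∩ G.compIn I σ u).ncard :=
    fun x hx u hu huσ hux => h.two_le_compIn hg h4 hx hu huσ hux (hnr u)
      (.base (Set.mem_insert _ _) hx)
  obtain ⟨d, hdI, hdσ, hda⟩ := hnbr a ha
  obtain ⟨e, heI, heσ, heb⟩ := hnbr b hb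
  obtain ⟨f, hfI, hfσ, hfc⟩ := hnbr c hc
  have hXD := mem_of_two_le (fun x hx => (ReachIn.mem hx).1) hX (hcomp a ha d hdI hdσ hda)
  have hmem : ∀ x ∈ σ, ∀ u ∈ I, u ∉ σ → G.Adj u x → u ∈ G.compIn I σ d := by
    intro x hx u hu huσ hux
    have h5 := hcomp x hx u hu huσ hux
    obtain ⟨y, hyX, hy⟩ := Set.nonempty_of_ncard_ne_zero (s := X ∩ G.compIn I σ u) (by omega)
    have hyD : G.ReachIn (I \ σ) {d} y := hXD y hyX (ReachIn.mem hy).1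
    refine ReachIn.trans (ReachIn.symm_single hy) fun p hp _ => ?_
    rw [Set.mem_singleton_iff.1 hp]
    exact hyD
  have heD := hmem b hb e heI heσ heb
  have hfD := hmem c hc f hfI hfσ hfc
  have hdD := hmem a ha d hdI hdσ hda
  have hef : e ≠ f := by
    rintro rfl
    exact hbc (h4 e heI heσ b hb c hc heb hfc)
  have hr := h.rooted_compIn h4 ha hdI hdσ hda (hnr d)
  have hg' := fun hg' =>
    hg (h.closePaths_of_compIn ha (hnr d) (.base (Set.mem_insert _ _) ha) hg')
  have hlt : (G.compIn I σ d).ncard < I.ncard := h.ncard_compIn_lt ha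
  have hE : (X ∩ G.compIn I σ d).ncard ≤ 2 :=
    (ncard_inter_le fun x hx => (ReachIn.mem hx).1).trans hX
  have he' : e ∈ G.nbrsIn (σ \ {a}) (G.compIn I σ d) := ⟨heD, b, ⟨hb, hab.symm⟩, heb⟩
  have hf' : f ∈ G.nbrsIn (σ \ {a}) (G.compIn I σ d) := ⟨hfD, c, ⟨hc, hac.symm⟩, hfc⟩
  have hd' : d ∈ G.nbrsIn {a} (G.compIn I σ d) := ⟨hdD, a, rfl, hda⟩
  have hl2 := two_le_ncard he' hf' hef
  have hdl : d ∉ G.nbrsIn (σ \ {a}) (G.compIn I σ d) := by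
    rintro ⟨_, w, hw, hdw⟩
    exact hw.2 (h4 d hdI hdσ w hw.1 a ha hdw hda)
  by_cases hr2 : 2 ≤ (G.nbrsIn {a} (G.compIn I σ d)).ncard
  · rw [← (ih _ _ _ _ hlt hr hE hl2 hr2 hg').1] at hd'
    exact hdl hd'
  · have hr1 : G.nbrsIn {a} (G.compIn I σ d) = {d} := by
      refine Set.eq_singleton_iff_unique_mem.2 ⟨hd', fun s hs => ?_⟩
      by_contra hst
      exact hr2 (two_le_ncard hs hd' hst)
    rw [hr1] at hr hg'
    obtain ⟨h5, _⟩ := hr.adj_of_singleton (ih.mono hlt.le) hE hl2 hdl hg'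
    have hed := h5 e he'
    have hfd := h5 f hf'
    have hσne : ∀ {x y}, x ∈ σ → y ∉ σ → x ≠ y := fun hx hy hxy => hy (hxy ▸ hx)
    -- The vertex d, sole neighbour of a in the component, is adjacent to e and f. The paths are b,
    -- e, d, a and b, e, d, f, c.
    have p1 := (((HasPathIn.nil (G := G) (I := {a}) (σ := {a}) rfl rfl ha).cons (u := d)
      (by simp [(hσne ha hdσ).symm]) hda).cons (u := e)
      (by simp [(hσne ha heσ).symm, hed.ne]) hed).cons (u := b)
      (by simp [hab.symm, hσne hb hdσ, hσne hb heσ]) heb.symm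
    have p2 := ((((HasPathIn.nil (G := G) (I := {c}) (σ := {c}) rfl rfl hc).cons (u := f)
      (by simp [(hσne hc hfσ).symm]) hfc).cons (u := d)
      (by simp [(hσne hc hdσ).symm, hfd.ne']) hfd.symm).cons (u := e)
      (by simp [(hσne hc heσ).symm, hed.ne, hef]) hed).cons (u := b)
      (by simp [hbc, hσne hb hdσ, hσne hb heσ, hσne hb hfσ]) heb.symm
    have haI := h.subset_left ha
    have hbI := h.subset_left hb
    have hcI := h.subset_left hc
    refine hg ⟨3, p1.mono ?_ (by simpa using hb) subset_rfl,
      .inl (p2.mono ?_ (by simpa using hb) subset_rfl)⟩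
    · simp [Set.insert_subset_iff, haI, hbI, heI, hdI]
    · simp [Set.insert_subset_iff, hcI, hbI, heI, hdI, hfI]

theorem eq_and_ncard_eq_two [Finite V] (h : G.IsRooted X I σ τ) (hX : (X ∩ I).ncard ≤ 2)
    (hσ2 : 2 ≤ σ.ncard) (hτ2 : 2 ≤ τ.ncard) (hg : ¬ G.HasClosePaths I σ τ) :
    σ = τ ∧ σ.ncard = 2 := by
  have main : ∀ n, G.SmallCase n := by
    intro n
    induction n with
    | zero => exact fun X I σ τ hI => absurd hI (Nat.not_lt_zero _)
    | succ n ihn =>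
      intro X I σ τ hI h hX hσ2 hτ2 hg
      have ih : G.SmallCase I.ncard := ihn.mono (by omega)
      have hg' : ¬ G.HasClosePaths I τ σ := fun hg' => hg hg'.symm
      have h4 : ∀ v ∈ I, v ∉ σ → ∀ a ∈ σ, ∀ b ∈ σ, G.Adj v a → G.Adj v b → a = b :=
        fun v hv hvσ a ha b hb hva hvb => h.eq_of_fourCycle ih hX hτ2 hg hv hvσ ha hb hva hvb
      have h4' : ∀ v ∈ I, v ∉ τ → ∀ a ∈ τ, ∀ b ∈ τ, G.Adj v a → G.Adj v b → a = b :=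
        fun v hv hvτ a ha b hb hva hvb =>
          h.symm.eq_of_fourCycle ih hX hσ2 hg' hv hvτ ha hb hva hvb
      by_cases hD : ∀ d ∈ I, d ∉ σ → G.ReachIn (I \ σ) τ d
      · exact h.eq_of_core ih hX hσ2 hτ2 hg h4 hD
      by_cases hD' : ∀ d ∈ I, d ∉ τ → G.ReachIn (I \ τ) σ d
      · obtain ⟨h1, h2⟩ := h.symm.eq_of_core ih hX hτ2 hσ2 hg' h4' hD'
        exact ⟨h1.symm, h1 ▸ h2⟩
      -- Contraction misses a component from either side, which forces both inclusions between σ and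
      -- τ.
      push Not at hD hD'
      obtain ⟨d, hdI, hdσ, hd⟩ := hD
      obtain ⟨e, heI, heτ, he⟩ := hD'
      obtain ⟨h1, h2⟩ := h.subset_of_not_reachIn hX hg h4 hdI hdσ hd
      obtain ⟨h3, _⟩ := h.symm.subset_of_not_reachIn hX hg' h4' heI heτ he
      have hστ : σ = τ := Set.Subset.antisymm h3 h1
      subst hστ
      exact ⟨rfl, h.ncard_eq_two_of_eq ih hX hσ2 hg h4 h2⟩
  exact main _ X I σ τ (Nat.lt_succ_self _) h hX hσ2 hτ2 hg

end IsRooted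

end SimpleGraph
namespace SimpleGraph

variable {V : Type*} {G : SimpleGraph V}

/-! ### From 2-connected graphs to rooted graphs and back -/

theorem Walk.reachIn {u v : V} (p : G.Walk u v) {S : Set V} (hp : ∀ x ∈ p.support, x ∈ S) :
    G.ReachIn S {v} u := by
  induction p with
  | nil => exact .base (hp _ (by simp)) rfl
  | cons h q ih =>
    exact .step (hp _ (by simp)) h (ih fun x hx => hp x (List.mem_cons_of_mem _ hx))

theorem reachIn_of_induce_connected {S : Set V} (h : (G.induce S).Connected) {u v : V}
    (hu : u ∈ S) (hv : v ∈ S) : G.ReachIn S {v} u := by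
  obtain ⟨p⟩ := h.preconnected ⟨u, hu⟩ ⟨v, hv⟩
  refine (p.map (Embedding.induce S).toHom).reachIn fun x hx => ?_
  rw [Walk.support_map, List.mem_map] at hx
  obtain ⟨y, _, rfl⟩ := hx
  exact y.2

theorem HasPathIn.exists_path {s t : V} {n : ℕ} (hst : s ≠ t)
    (h : G.HasPathIn {s, t}ᶜ (G.neighborSet s) (G.neighborSet t) n) :
    ∃ p : G.Walk s t, p.IsPath ∧ p.length = n + 2 := by
  have h1 : ∀ v ∈ G.neighborSet t, ∃ c, G.Adj v c ∧ G.HasPathIn {t} {c} {t} 0 :=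
    fun v hv => ⟨t, hv.symm, .nil rfl rfl rfl⟩
  have h2 := (h.append h1 (Set.disjoint_left.2 fun x hx hxt => hx (.inr hxt))).symm
  have h3 : ∀ v ∈ G.neighborSet s, ∃ c, G.Adj v c ∧ G.HasPathIn {s} {c} {s} 0 :=
    fun v hv => ⟨s, hv.symm, .nil rfl rfl rfl⟩
  obtain ⟨u, rfl, v, rfl, p, hp, _, hl⟩ := (h2.append h3 (Set.disjoint_left.2 fun x hx hxs => by
    rcases hx with hx | hx
    · exact hx (.inl hxs)
    · exact hst (hxs.symm.trans hx))).symm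
  exact ⟨p, hp, by omega⟩

theorem HasClosePaths.exists_paths {s t : V} (hst : s ≠ t)
    (h : G.HasClosePaths {s, t}ᶜ (G.neighborSet s) (G.neighborSet t)) :
    ∃ p q : G.Walk s t, p.IsPath ∧ q.IsPath ∧
      (p.length : ℤ) - (q.length : ℤ) ∈ ({1, 2} : Set ℤ) := by
  obtain ⟨n, h1, h2⟩ := h
  obtain ⟨q, hq, hql⟩ := h1.exists_path hst
  rcases h2 with h2 | h2
  · obtain ⟨p, hp, hpl⟩ := h2.exists_path hst
    exact ⟨p, q, hp, hq, .inl (by omega)⟩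
  · obtain ⟨p, hp, hpl⟩ := h2.exists_path hst
    exact ⟨p, q, hp, hq, .inr (Set.mem_singleton_iff.2 (by omega))⟩

/-- Removing two nonadjacent vertices from a 2-connected graph. -/
theorem IsTwoConnected.isRooted [Fintype V] (hG : G.IsTwoConnected) {X : Set V} {s t : V}
    (hst : s ≠ t) (hadj : ¬ G.Adj s t)
    (hdeg : ∀ v, v ≠ s → v ≠ t → v ∉ X → 3 ≤ (G.neighborSet v).ncard) :
    G.IsRooted X {s, t}ᶜ (G.neighborSet s) (G.neighborSet t) := by
  have key : ∀ s t : V, s ≠ t → ∀ v ∈ ({s, t} : Set V)ᶜ,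
      G.ReachIn ({s, t} : Set V)ᶜ (G.neighborSet s) v := by
    intro s t hst v hv
    have hvt : v ≠ t := fun h => hv (.inr h)
    refine ((reachIn_of_induce_connected (hG.2.2 t) (u := v) (v := s) hvt hst).restrict
      (J := {s, t}ᶜ) (Q := G.neighborSet s) hv ?_ ?_).mono (fun x hx => hx.2) fun _ _ h => h
    · exact fun x hx _ hxs => absurd (.inl hxs) hx
    · intro x _ _ y hy hyJ hxy
      have hys : y = s := (not_not.1 hyJ).resolve_right hy
      exact hys ▸ hxy.symm
  refine ⟨?_, ?_, key s t hst, ?_, ?_, ?_⟩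
  · rintro x hx (rfl | rfl)
    · exact G.loopless.irrefl _ hx
    · exact hadj hx
  · rintro x hx (rfl | rfl)
    · exact hadj hx.symm
    · exact G.loopless.irrefl _ hx
  · rw [Set.pair_comm]
    exact key t s hst.symm
  · intro v hv u hu huv
    have hvs : s ≠ v := fun h => hv (.inl h.symm)
    refine ((reachIn_of_induce_connected (hG.2.2 v) (u := u) (v := s) huv hvs).restrict
      (J := {s, t}ᶜ) (Q := G.neighborSet s ∪ G.neighborSet t) hu ?_ ?_).mono
        (fun x hx => ⟨hx.2, hx.1⟩) fun _ _ h => h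
    · exact fun x hx _ hxs => absurd (.inl hxs) hx
    · intro x _ _ y hy hyJ hxy
      rcases not_not.1 hyJ with rfl | rfl
      · exact .inl hxy.symm
      · exact .inr hxy.symm
  · intro v hv hX
    refine (hdeg v (fun h => hv (.inl h)) (fun h => hv (.inr h)) hX).trans ?_
    have h1 : G.neighborSet v ⊆ (G.neighborSet v ∩ {s, t}ᶜ) ∪ (G.neighborSet v ∩ {s}) ∪
        (G.neighborSet v ∩ {t}) := by
      intro w hw
      by_cases hws : w = s
      · exact .inl (.inr ⟨hw, hws⟩)
      by_cases hwt : w = t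
      · exact .inr ⟨hw, hwt⟩
      · exact .inl (.inl ⟨hw, fun h => h.elim hws hwt⟩)
    have h2 := (Set.ncard_le_ncard h1 (Set.toFinite _)).trans ((Set.ncard_union_le _ _).trans
      (Nat.add_le_add_right (Set.ncard_union_le _ _) _))
    have h3 : ∀ r : V, (G.neighborSet v ∩ {r}).ncard ≤ 1 := fun r =>
      (Set.ncard_le_ncard Set.inter_subset_right (Set.toFinite _)).trans_eq (Set.ncard_singleton r)
    have h4 : ∀ r : V, v ∉ G.neighborSet r → (G.neighborSet v ∩ {r}).ncard = 0 := by
      intro r hr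
      rw [Set.ncard_eq_zero (Set.toFinite _)]
      refine Set.eq_empty_iff_forall_notMem.2 fun w hw => hr ?_
      exact (Set.mem_singleton_iff.1 hw.2 ▸ hw.1 : G.Adj v r).symm
    have h5 := h3 s
    have h6 := h3 t
    unfold rootedDegree
    by_cases hs : v ∈ G.neighborSet s <;> by_cases ht : v ∈ G.neighborSet t
    · rw [if_pos hs, if_pos ht]
      omega
    · have := h4 t ht
      rw [if_pos hs, if_neg ht]
      omega
    · have := h4 s hs
      rw [if_neg hs, if_pos ht]
      omega
    · have := h4 s hs
      have := h4 t ht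
      rw [if_neg hs, if_neg ht]
      omega

end SimpleGraph

theorem mainTheorem8 {V : Type*} [Fintype V] (G : SimpleGraph V) [DecidableRel G.Adj]
    (hG : G.IsTwoConnected) (x₁ x₂ y z : V)
    (hdistinct : [x₁, x₂, y, z].Nodup)
    (hx₁ : G.degree x₁ = 2) (hx₂ : G.degree x₂ = 2) (hy : G.degree y = 2) (hz : G.degree z = 2)
    (hdeg : ∀ v : V, v ∉ ({x₁, x₂, y, z} : Set V) → G.degree v = 3)
    (hadj : ¬ G.Adj x₁ x₂)
    (hopp : ¬ G.AreOppositeInFourCycle x₁ x₂) :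
    ∃ P₁ P₂ : G.Walk x₁ x₂, P₁.IsPath ∧ P₂.IsPath ∧
      (P₁.length : ℤ) - (P₂.length : ℤ) ∈ ({1, 2} : Set ℤ) := by
  have hne : x₁ ≠ x₂ := by
    rintro rfl
    simp at hdistinct
  have hcard : ∀ v, (G.neighborSet v).ncard = G.degree v := fun v => by
    rw [← Nat.card_coe_set_eq, Nat.card_eq_fintype_card, G.card_neighborSet_eq_degree]
  have hr := hG.isRooted (X := {y, z}) hne hadj fun v h1 h2 h3 => by
    rw [hcard, hdeg v]
    rintro (h | h | h)
    exacts [h1 h, h2 h, h3 h]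
  refine SimpleGraph.HasClosePaths.exists_paths hne ?_
  by_contra hg
  obtain ⟨h1, h2⟩ := hr.eq_and_ncard_eq_two
    ((Set.ncard_le_ncard Set.inter_subset_left (Set.toFinite _)).trans
      ((Set.ncard_insert_le y {z}).trans (by rw [Set.ncard_singleton])))
    (hcard x₁ ▸ hx₁.ge) (hcard x₂ ▸ hx₂.ge) hg
  -- The two common neighbours of `x₁` and `x₂` form the excluded 4-cycle with them.
  obtain ⟨a, b, hab, hs⟩ := Set.ncard_eq_two.1 h2
  have ha : a ∈ G.neighborSet x₁ := hs ▸ .inl rfl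
  have hb : b ∈ G.neighborSet x₁ := hs ▸ .inr rfl
  have ha' : a ∈ G.neighborSet x₂ := h1 ▸ ha
  have hb' : b ∈ G.neighborSet x₂ := h1 ▸ hb
  exact hopp ⟨a, b, hne, hab, ha, ha'.symm, hb', hb.symm⟩
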